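/- **Corollary 5.8 (differential Eisenstein series are automorphic integrals).** Let $\mathbb H$ be the upper half plane. Complex powers $z^{s}$ ($z\neq 0$) are taken with $-\pi\le\arg z<\pi$. For $\tau\in\mathbb H$ and $\operatorname{Re}s>2$ put $$G(s,\tau)=\sum_{(m,n)\in\mathbb Z^2\setminus\{(0,0)\}}(m\tau+n)^{-s},\qquad G^{(a,b)}(s,\tau)=\sum_{\substack{(m,n)\in\mathbb Z^2\setminus\{(0,0)\}\\ m\equiv a,\ n\equiv b\ (\mathrm{mod}\ 2)}}(m\tau+n)^{-s}.$$ For $(a,b)\in\{(0,0),(1,1)\}$ these series converge absolutely and extend to entire functions of $s$; for $m\in\mathbb Z$ let $G'_m(\tau)=\frac{\partial}{\partial s}G(s,\tau)\big|_{s=m}$ and $G'^{(a,b)}_m(\tau)=\frac{\partial}{\partial s}G^{(a,b)}(s,\tau)\big|_{s=m}$. Let $\mathbb C(\tau)$ be the space of rational functions of $\tau$ without poles in $\mathbb H$, and for $\gamma=\begin{pmatrix}a&b\\c&d\end{pmatrix}\in SL_2(\mathbb Z)$ let $(f|_m\gamma)(\tau)=(c\tau+d)^{-m}f\bigl(\tfrac{a\tau+b}{c\tau+d}\bigr)$.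 Let $M_m(SL_2(\mathbb Z),\mathbb C(\tau))$ be the set of holomorphic functions $f$ on $\mathbb H$ such that $f(\tau+1)=f(\tau)$; $f|_m\gamma-f\in\mathbb C(\tau)$ for all $\gamma\in SL_2(\mathbb Z)$; and for every $\gamma\in SL_2(\mathbb Z)$ there are $a_n\in\mathbb C$ $(n\in\mathbb Z)$, with $a_n=0$ for $n\ll0$, such that $(f|_m\gamma)(\tau)-\sum_{n}a_ne^{2\pi in\tau}\in\mathbb C(\tau)$. For $\mathfrak G(2)=\left\langle\begin{pmatrix}1&2\\0&1\end{pmatrix},\begin{pmatrix}0&-1\\1&0\end{pmatrix}\right\rangle$ let $M_m(\mathfrak G(2),\mathbb C(\tau))$ be the set of holomorphic functions $f$ on $\mathbb H$ such that $f(\tau+2)=f(\tau)$; $\tau^{-m}f(-1/\tau)-f(\tau)\in\mathbb C(\tau)$; and $f$ is holomorphic at $i\infty$, i.e. $f(\tau)=\sum_{n\ge0}a_ne^{\pi in\tau}$ on $\mathbb H$ for some $a_n\in\mathbb C$. Then for every integer $k\ge1$ $$G'_{-2k}\in M_{-2k}(SL_2(\mathbb Z),\mathbb C(\tau)),\qquad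 G'^{(0,0)}_{-2k},\ G'^{(1,1)}_{-2k}\in M_{-2k}(\mathfrak G(2),\mathbb C(\tau)).$$ Moreover, for every $\tau\in\mathbb H$, Barnes' double zeta function $\zeta_2(s,\tau\,|\,(-1,\tau))=\sum_{m,n\ge0}(-m+n\tau+\tau)^{-s}$ (absolutely convergent for $\operatorname{Re}s>2$) extends meromorphically to $s\in\mathbb C$, is holomorphic at $s=-2k$, and $$G'_{-2k}\Bigl(-\frac1\tau\Bigr)=\Bigl(-\frac1\tau\Bigr)^{2k}\Bigl(G'_{-2k}(\tau)+2\pi i\,\zeta_2\bigl(-2k,\tau\,|\,(-1,\tau)\bigr)\Bigr).$$ -/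

import Mathlib

open Complex
open UpperHalfPlane hiding I
open scoped ModularForm MatrixGroups Manifold

noncomputable section

namespace DiffEisenstein

/-! ### Complex powers and analytic continuation -/

/-- The argument of `z` normalized by `-π ≤ arg z < π`. -/
def branchArg (z : ℂ) : ℝ := if z.arg = Real.pi then -Real.pi else z.arg

/-- The power `z ^ s` for `z ≠ 0`, for the branch `-π ≤ arg z < π`. -/
def branchPow (z s : ℂ) : ℂ := Complex.exp (s * ((Real.log ‖z‖ : ℂ) + (branchArg z : ℂ) * I))

/-- `F` is an entire function which on `Re s > 2` is the sum of the (unconditionally, hence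
absolutely) convergent series of functions `∑ i, u i s`. -/
def IsEntireContinuation {ι : Type} (u : ι → ℂ → ℂ) (F : ℂ → ℂ) : Prop :=
  Differentiable ℂ F ∧ ∀ s : ℂ, 2 < s.re → HasSum (fun i => u i s) (F s)

open Classical in
/-- The analytic continuation to the whole plane of the series `∑ i, u i s`, `Re s > 2`. It is
unique if it exists, by the identity theorem; the value is `0` if it does not exist. -/
def entireContinuation {ι : Type} (u : ι → ℂ → ℂ) : ℂ → ℂ :=
  if h : ∃ F, IsEntireContinuation u F then h.choose else 0

/-- `F` is a meromorphic function on the whole plane which on `Re s > 2` is the sum of the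
convergent series `∑ i, u i s`. Normal form means that removable singularities are removed
(and that the value at a pole is by convention `0`). -/
def IsMeromorphicContinuation {ι : Type} (u : ι → ℂ → ℂ) (F : ℂ → ℂ) : Prop :=
  MeromorphicNFOn F Set.univ ∧ ∀ s : ℂ, 2 < s.re → HasSum (fun i => u i s) (F s)

open Classical in
/-- The meromorphic continuation to the whole plane of the series `∑ i, u i s`, `Re s > 2`. It is
unique if it exists, by the identity theorem; the value is `0` if it does not exist. -/
def meromorphicContinuation {ι : Type} (u : ι → ℂ → ℂ) : ℂ → ℂ :=
  if h : ∃ F, IsMeromorphicContinuation u F then h.choose else 0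

/-! ### Generalized and differential Eisenstein series -/

/-- The summand `(m τ + n) ^ (-s)` at `p = (m, n)`. The pair `(0, 0)`, where the summand is not
defined, is left out of the sum, i.e. contributes `0`. -/
def eisTerm (τ : ℍ) (p : ℤ × ℤ) (s : ℂ) : ℂ :=
  if p = (0, 0) then 0 else branchPow ((p.1 : ℂ) * (τ : ℂ) + (p.2 : ℂ)) (-s)

/-- The summand of the series over the pairs `(m, n)` with `m ≡ a`, `n ≡ b` modulo `N`. -/
def eisTermMod (N : ℕ) (a b : ℤ) (τ : ℍ) (p : ℤ × ℤ) (s : ℂ) : ℂ :=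
  if p.1 ≡ a [ZMOD (N : ℤ)] ∧ p.2 ≡ b [ZMOD (N : ℤ)] then eisTerm τ p s else 0

/-- The generalized Eisenstein series `G(s, τ)`, continued to all `s`. -/
def genG (s : ℂ) (τ : ℍ) : ℂ := entireContinuation (eisTerm τ) s

/-- The generalized Eisenstein series `G_N^{(a,b)}(s, τ)`, continued to all `s`. -/
def genGMod (N : ℕ) (a b : ℤ) (s : ℂ) (τ : ℍ) : ℂ := entireContinuation (eisTermMod N a b τ) s

/-- The differential Eisenstein series `G'_m(τ) = ∂/∂s G(s, τ)` at `s = m`. -/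
def dG (m : ℤ) (τ : ℍ) : ℂ := deriv (fun s => genG s τ) (m : ℂ)

/-- The differential Eisenstein series `∂/∂s G_N^{(a,b)}(s, τ)` at `s = m`. -/
def dGMod (N : ℕ) (a b : ℤ) (m : ℤ) (τ : ℍ) : ℂ := deriv (fun s => genGMod N a b s τ) (m : ℂ)

/-! ### Barnes' double zeta function -/

/-- The summand `(m ω₁ + n ω₂ + z) ^ (-s)` at `p = (m, n)`. -/
def barnesTerm (z ω₁ ω₂ : ℂ) (p : ℕ × ℕ) (s : ℂ) : ℂ :=
  branchPow ((p.1 : ℂ) * ω₁ + (p.2 : ℂ) * ω₂ + z) (-s)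

/-- Barnes' double zeta function `ζ₂(s, z | (ω₁, ω₂))`, continued meromorphically in `s`. -/
def barnesZeta (s z ω₁ ω₂ : ℂ) : ℂ := meromorphicContinuation (barnesTerm z ω₁ ω₂) s

/-! ### Periodic automorphic integrals -/

/-- The space `ℂ(τ)` of rational functions on the upper half plane, as functions `ℍ → ℂ`
(thus without poles in `ℍ`). -/
def rationalFunctions : Submodule ℂ (ℍ → ℂ) where
  carrier := {R | ∃ P Q : Polynomial ℂ, ∀ τ : ℍ,
    Q.eval (τ : ℂ) ≠ 0 ∧ R τ = P.eval (τ : ℂ) / Q.eval (τ : ℂ)}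
  add_mem' := by
    rintro R₁ R₂ ⟨P₁, Q₁, h₁⟩ ⟨P₂, Q₂, h₂⟩
    refine ⟨P₁ * Q₂ + Q₁ * P₂, Q₁ * Q₂, fun τ => ⟨?_, ?_⟩⟩
    · simpa using ⟨(h₁ τ).1, (h₂ τ).1⟩
    · simp [(h₁ τ).2, (h₂ τ).2, div_add_div _ _ (h₁ τ).1 (h₂ τ).1]
  zero_mem' := ⟨0, 1, fun τ => by simp⟩
  smul_mem' := by
    rintro c R ⟨P, Q, h⟩
    exact ⟨Polynomial.C c * P, Q, fun τ => ⟨(h τ).1, by simp [(h τ).2, mul_div_assoc]⟩⟩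

/-- The set `M_m(Γ, 𝔛)` of periodic automorphic integrals of weight `m` (with trivial character)
for a congruence subgroup `Γ` of level `N`, with period functions in `𝔛`. Here
`(f ∣[m] γ) τ = (c τ + d) ^ (-m) * f (γ τ)`. -/
def M (Γ : Subgroup SL(2, ℤ)) (N : ℕ) (m : ℤ) (X : Submodule ℂ (ℍ → ℂ)) : Set (ℍ → ℂ) :=
  {f | MDifferentiable 𝓘(ℂ) 𝓘(ℂ) f ∧
    (∀ τ : ℍ, f ((N : ℝ) +ᵥ τ) = f τ) ∧
    (∀ γ ∈ Γ, f ∣[m] γ - f ∈ X) ∧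
    (∀ γ : SL(2, ℤ), ∃ (a : ℤ → ℂ) (n₀ : ℤ) (R : ℍ → ℂ), (∀ n < n₀, a n = 0) ∧ R ∈ X ∧
      ∀ τ : ℍ, HasSum (fun n : ℤ => a n * cexp (2 * Real.pi * I * τ * n / N))
        ((f ∣[m] γ) τ - R τ))}

/-- The set `M_m(𝔊(2), 𝔛)` for `𝔊(2) = ⟨T², S⟩`: the holomorphic functions `f` on `ℍ` with
`f (τ + 2) = f τ` and `τ ^ (-m) * f (-1/τ) - f τ` in `𝔛` which are holomorphic at `i∞`, i.e. have
an expansion in nonnegative powers of `exp (π i τ)`. -/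
def MG2 (m : ℤ) (X : Submodule ℂ (ℍ → ℂ)) : Set (ℍ → ℂ) :=
  {f | MDifferentiable 𝓘(ℂ) 𝓘(ℂ) f ∧
    (∀ τ : ℍ, f ((2 : ℝ) +ᵥ τ) = f τ) ∧
    (fun τ : ℍ => (τ : ℂ) ^ (-m) * f (ModularGroup.S • τ) - f τ) ∈ X ∧
    ∃ a : ℕ → ℂ, ∀ τ : ℍ, HasSum (fun n : ℕ => a n * cexp (Real.pi * I * τ * n)) (f τ)}

end DiffEisenstein

end

namespace DiffEisenstein

/-! ### The branch of complex powers -/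

/-! Take one lattice point from each pair `±(m τ + n)`, the one with argument in `[0, π)`. For this
branch, passing to the negative multiplies the term by `exp (π i s)`, so `G` is `(1 + exp (π i s))`
times the half-lattice sum `upperSum`. By the Lipschitz formula this half sum is `ζ(s)` (absent for
odd coordinates) plus `lipschitzFactor s`, which contains `1 / Γ(s)`, times a double exponential
series entire in `s`. The zero of `1 + exp (π i s)` at `1` cancels the pole of `ζ`, giving the
entire continuation `eisEntire`. At `s = -2 k` both `ζ` and `1 / Γ` vanish, so `G` vanishes and its
derivative is a constant plus a constant times the exponential series. Holomorphy, periodicity and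
the Fourier expansion can be read off from this (`hasDerivAt_eisEntire`).

Under `τ ↦ -1 / τ` the lattice is rotated and divided by `τ`. The powers are multiplicative except
at the negatives of the points with argument in `[0, arg τ)`, where the branch jumps. Hence `G(s,
-1/τ) = τ ^ s (G(s, τ) + (exp (-π i s) - exp (π i s)) W(s))`, where `W` is the sum over this wedge
(`eisEntire_S_smul`). At `-2 k` the factor of `W` vanishes with derivative `-2 π i`, so the period
function is `-2 π i W(-2 k)` (`eisDeriv_S_smul`).

The sum `W` is continued as a Mellin transform, along a ray on which all wedge points decay, of a
product of two geometric series. Its values at nonpositive integers involve only finitely many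
Taylor coefficients, which makes them rational in `τ` (`exists_wedge_continuation`). The cocycle
relation spreads rationality from the generators to the modular group. Finally, the half lattice
minus the wedge is Barnes' double series; since the half sum is zero at `-2 k`, Barnes' value there
is `-W(-2 k)` (`barnesZeta_spec`). -/

/-- All branch computations go through this: write the base as `exp L` with `Im L` in `[-π, π)` and
the power is read off from `L`. -/
lemma branchPow_exp {L : ℂ} (h1 : -Real.pi ≤ L.im) (h2 : L.im < Real.pi) (s : ℂ) :
    branchPow (exp L) s = exp (s * L) := by
  have hL : ((Real.log ‖exp L‖ : ℂ) + (branchArg (exp L) : ℂ) * I) = L := by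
    have hb : branchArg (exp L) = L.im := by
      rcases h1.eq_or_lt with h | h
      -- On the edge `Im L = -π` the principal argument is `π`, seen by shifting `L` by `2 π i`;
      -- `branchArg` then turns it back into `-π`.
      · have : (exp L).arg = Real.pi := by
          have hL : exp L = exp (L + 2 * Real.pi * I) := by
            rw [Complex.exp_add, Complex.exp_two_pi_mul_I, mul_one]
          have him : (L + 2 * Real.pi * I).im = Real.pi := by
            simp [← h]; ring
          rw [hL, ← Complex.log_im, Complex.log_exp] <;> rw [him]
          linarith [Real.pi_pos]
        simp [branchArg, this, ← h]
      · have : (exp L).arg = L.im := by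
          rw [← Complex.log_im, Complex.log_exp h h2.le]
        simp [branchArg, this, h2.ne]
    rw [hb, Complex.norm_exp, Real.log_exp, Complex.re_add_im]
  rw [branchPow, hL]

lemma branchPow_of_arg_nonneg {z : ℂ} (hz : z ≠ 0) (h0 : 0 ≤ z.arg) (h1 : z.arg < Real.pi) (s : ℂ) :
    branchPow z s = z ^ s := by
  have := Real.pi_pos
  conv_lhs => rw [← Complex.exp_log hz]
  rw [branchPow_exp (by rw [log_im]; linarith) (by rwa [log_im]), cpow_def_of_ne_zero hz, mul_comm]

/-- The logarithm of `-z` is `log z - π i`, with imaginary part in `[-π, 0)`. Including `-π` in the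
branch is what covers positive real `z`. -/
lemma branchPow_neg_of_arg_nonneg {z : ℂ} (hz : z ≠ 0) (h0 : 0 ≤ z.arg) (h1 : z.arg < Real.pi)
    (s : ℂ) : branchPow (-z) s = exp (-(Real.pi * I * s)) * z ^ s := by
  have := Real.pi_pos
  have h : -z = exp (log z - Real.pi * I) := by
    rw [exp_sub, exp_log hz, exp_pi_mul_I, div_neg, div_one]
  have him : (log z - Real.pi * I).im = z.arg - Real.pi := by simp [log_im]
  rw [h, branchPow_exp (by rw [him]; linarith) (by rw [him]; linarith), cpow_def_of_ne_zero hz,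
    ← exp_add]
  ring_nf

lemma norm_branchPow_le {z : ℂ} (hz : z ≠ 0) (s : ℂ) :
    ‖branchPow z s‖ ≤ Real.exp (Real.pi * |s.im|) * ‖z‖ ^ s.re := by
  have hb : |branchArg z| ≤ Real.pi := by
    unfold branchArg
    split_ifs
    · simp [abs_of_pos Real.pi_pos]
    · exact abs_arg_le_pi z
  rw [branchPow, norm_exp, Real.rpow_def_of_pos (norm_pos_iff.2 hz), ← Real.exp_add]
  apply Real.exp_le_exp.2
  have h1 : (s * ((Real.log ‖z‖ : ℂ) + (branchArg z : ℂ) * I)).re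
      = s.re * Real.log ‖z‖ - s.im * branchArg z := by simp
  have h2 : -(s.im * branchArg z) ≤ |branchArg z| * |s.im| := by
    rw [mul_comm, ← abs_mul]; exact neg_le_abs _
  have h3 := mul_le_mul_of_nonneg_right hb (abs_nonneg s.im)
  rw [h1]; linarith

lemma branchPow_div {z : ℂ} (hz : z ≠ 0) (h0 : 0 ≤ z.arg) (h1 : z.arg < Real.pi)
    (τ : ℍ) (s : ℂ) : branchPow (z / τ) s = (τ : ℂ) ^ (-s) * z ^ s := by
  have hτ0 : 0 ≤ (τ : ℂ).arg := arg_nonneg_iff.2 τ.im_pos.le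
  have hτ1 : (τ : ℂ).arg < Real.pi := arg_lt_pi_iff.2 (Or.inr τ.im_pos.ne')
  have hτ2 : 0 < (τ : ℂ).arg := hτ0.lt_of_ne' fun h => by
    have := (arg_eq_zero_iff.1 h).2; exact τ.im_pos.ne' this
  have h : z / τ = exp (log z - log τ) := by rw [exp_sub, exp_log hz, exp_log τ.ne_zero]
  have him : (log z - log τ).im = z.arg - (τ : ℂ).arg := by simp [log_im]
  rw [h, branchPow_exp (by rw [him]; linarith) (by rw [him]; linarith), cpow_def_of_ne_zero hz,
    cpow_def_of_ne_zero τ.ne_zero, ← exp_add]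
  ring_nf

/-- The imaginary part of `log z - log τ` is `arg z - arg τ`, and `π i` must be added when it is
negative and subtracted otherwise to stay in `[-π, π)`. The sign is that of `Im (z / τ)`, so the
branch jumps across the ray through `τ`. -/
lemma branchPow_neg_div {z : ℂ} (hz : z ≠ 0) (h0 : 0 ≤ z.arg) (h1 : z.arg < Real.pi)
    (τ : ℍ) (s : ℂ) : branchPow (-z / τ) s =
      exp ((if (z / τ).im < 0 then 1 else -1) * (Real.pi * I * s)) * ((τ : ℂ) ^ (-s) * z ^ s) := by
  have hτ0 : 0 ≤ (τ : ℂ).arg := arg_nonneg_iff.2 τ.im_pos.le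
  have hτ1 : (τ : ℂ).arg < Real.pi := arg_lt_pi_iff.2 (Or.inr τ.im_pos.ne')
  have hτ2 : 0 < (τ : ℂ).arg := hτ0.lt_of_ne' fun h => by
    have := (arg_eq_zero_iff.1 h).2; exact τ.im_pos.ne' this
  have h : z / τ = exp (log z - log τ) := by rw [exp_sub, exp_log hz, exp_log τ.ne_zero]
  have him : (log z - log τ).im = z.arg - (τ : ℂ).arg := by simp [log_im]
  have hi : (z / τ).im = Real.exp ((log z - log τ).re) * Real.sin (z.arg - (τ : ℂ).arg) := by
    rw [h, exp_im, him]
  have key : ∀ e : ℂ, exp (e * (Real.pi * I)) = -1 → -Real.pi ≤ (log z - log τ + e * (Real.pi * I)).im →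
      (log z - log τ + e * (Real.pi * I)).im < Real.pi →
      branchPow (-z / τ) s = exp (e * (Real.pi * I * s)) * ((τ : ℂ) ^ (-s) * z ^ s) := by
    intro e he e1 e2
    have h' : -z / τ = exp (log z - log τ + e * (Real.pi * I)) := by
      rw [exp_add, ← h, he]; ring
    rw [h', branchPow_exp e1 e2, cpow_def_of_ne_zero hz,
      cpow_def_of_ne_zero τ.ne_zero, ← exp_add, ← exp_add]
    ring_nf
  split_ifs with hlt
  · have : z.arg - (τ : ℂ).arg < 0 := by
      by_contra hc
      push Not at hc
      rw [hi] at hlt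
      have := Real.sin_nonneg_of_nonneg_of_le_pi hc (by linarith)
      have := mul_nonneg (Real.exp_pos (log z - log τ).re).le this
      linarith
    apply key 1 (by simp [exp_pi_mul_I]) <;> rw [add_im, him] <;> simp <;> linarith
  · have : 0 ≤ z.arg - (τ : ℂ).arg := by
      by_contra hc
      push Not at hc
      apply hlt
      rw [hi]
      exact mul_neg_of_pos_of_neg (Real.exp_pos _) (Real.sin_neg_of_neg_of_neg_pi_lt hc (by linarith))
    apply key (-1) (by rw [neg_one_mul, exp_neg, exp_pi_mul_I]; norm_num) <;> rw [add_im, him] <;>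
      simp <;> linarith

/-! ### Lattice points -/

/-- The pairs `(m, n)` for which `m τ + n` has argument in `[0, π)`. -/
def posPairs : Set (ℤ × ℤ) := {p | 0 < p.1 ∨ p.1 = 0 ∧ 0 < p.2}

/-- The pairs `(m, n)` with `m ≥ 0`, `n > 0`: those for which `m τ + n` has argument
in `[0, arg τ)`. -/
def wedgePairs : Set (ℤ × ℤ) := {p | 0 ≤ p.1 ∧ 0 < p.2}

lemma wedgePairs_subset : wedgePairs ⊆ posPairs := by
  rintro ⟨m, n⟩ ⟨h1, h2⟩
  simp only [posPairs, Set.mem_ofPred_eq] at *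
  omega

lemma pos_ne_zero {p : ℤ × ℤ} (hp : p ∈ posPairs) : p ≠ (0, 0) := by
  rintro rfl; simp [posPairs] at hp

lemma neg_mem_posPairs {p : ℤ × ℤ} (hp : p ≠ (0, 0)) : -p ∈ posPairs ↔ p ∉ posPairs := by
  obtain ⟨m, n⟩ := p
  simp only [ne_eq, Prod.mk.injEq, not_and, posPairs, Set.mem_ofPred_eq, Prod.fst_neg, Prod.snd_neg] at *
  omega

lemma latticePt_pos (τ : ℍ) {p : ℤ × ℤ} (hp : p ∈ posPairs) :
    (p.1 : ℂ) * (τ : ℂ) + (p.2 : ℂ) ≠ 0 ∧ 0 ≤ ((p.1 : ℂ) * (τ : ℂ) + (p.2 : ℂ)).arg ∧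
      ((p.1 : ℂ) * (τ : ℂ) + (p.2 : ℂ)).arg < Real.pi := by
  have him : ((p.1 : ℂ) * (τ : ℂ) + (p.2 : ℂ)).im = p.1 * τ.im := by simp
  have hre : ((p.1 : ℂ) * (τ : ℂ) + (p.2 : ℂ)).re = p.1 * τ.re + p.2 := by simp
  rw [arg_nonneg_iff, arg_lt_pi_iff, him, hre]
  rcases hp with h | ⟨h, h'⟩
  · have h1 : (0 : ℝ) < p.1 := by exact_mod_cast h
    have h2 := mul_pos h1 τ.im_pos
    refine ⟨fun h0 => ?_, h2.le, Or.inr h2.ne'⟩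
    rw [h0, zero_im] at him; exact h2.ne him
  · have h1 : (0 : ℝ) < p.2 := by exact_mod_cast h'
    refine ⟨fun h0 => ?_, by simp [h], Or.inl (by simp [h, h1.le])⟩
    rw [h0, zero_re, h] at hre; simp at hre; linarith

lemma latticePt_ne_zero (τ : ℍ) {p : ℤ × ℤ} (hp : p ≠ (0, 0)) :
    (p.1 : ℂ) * (τ : ℂ) + (p.2 : ℂ) ≠ 0 := by
  intro h0
  by_cases hpos : p ∈ posPairs
  · exact (latticePt_pos τ hpos).1 h0
  · apply (latticePt_pos τ ((neg_mem_posPairs hp).2 hpos)).1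
    rw [← neg_eq_zero.2 h0]; simp; ring

lemma latticePt_div_im (τ : ℍ) (p : ℤ × ℤ) :
    (((p.1 : ℂ) * (τ : ℂ) + (p.2 : ℂ)) / τ).im < 0 ↔ 0 < p.2 := by
  have h : ((p.1 : ℂ) * (τ : ℂ) + (p.2 : ℂ)) / τ = p.1 + p.2 * (τ : ℂ)⁻¹ := by
    have := τ.ne_zero
    field_simp
  have h2 : (((p.1 : ℂ) * (τ : ℂ) + (p.2 : ℂ)) / τ).im = -(p.2 * (τ.im / normSq τ)) := by
    rw [h]; simp [neg_div]
  rw [h2, neg_lt_zero, mul_pos_iff_of_pos_right (div_pos τ.im_pos (normSq_pos.2 τ.ne_zero))]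
  exact_mod_cast Iff.rfl

lemma eisTerm_of_pos (τ : ℍ) {p : ℤ × ℤ} (hp : p ∈ posPairs) (s : ℂ) :
    eisTerm τ p s = ((p.1 : ℂ) * (τ : ℂ) + (p.2 : ℂ)) ^ (-s) := by
  obtain ⟨h, h0, h1⟩ := latticePt_pos τ hp
  rw [eisTerm, if_neg (pos_ne_zero hp), branchPow_of_arg_nonneg h h0 h1]

lemma eisTerm_neg_of_pos (τ : ℍ) {p : ℤ × ℤ} (hp : p ∈ posPairs) (s : ℂ) :
    eisTerm τ (-p) s = exp (Real.pi * I * s) * eisTerm τ p s := by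
  obtain ⟨h, h0, h1⟩ := latticePt_pos τ hp
  rw [eisTerm_of_pos τ hp, eisTerm, if_neg (fun h => pos_ne_zero hp (by simpa using congrArg Neg.neg h))]
  have : (((-p).1 : ℤ) : ℂ) * (τ : ℂ) + ((-p).2 : ℤ) = -((p.1 : ℂ) * (τ : ℂ) + (p.2 : ℂ)) := by
    simp; ring
  rw [this, branchPow_neg_of_arg_nonneg h h0 h1]
  simp

/-- The bijection `(m, n) ↦ (n, -m)` of pairs. -/
def rotatePair : ℤ × ℤ ≃ ℤ × ℤ where
  toFun p := (p.2, -p.1)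
  invFun p := (-p.2, p.1)
  left_inv p := by simp
  right_inv p := by simp

-- The point `m (-1/τ) + n` equals `(n τ - m) / τ`. The factor `exp (±π i s)` acquired by a negative
-- point depends on the side of the ray through `τ`; outside the wedge it agrees with the factor
-- already in `eisTerm`, inside it does not, and the difference is the correction term.
open Classical in
lemma eisTerm_S_smul (τ : ℍ) (p : ℤ × ℤ) (s : ℂ) :
    eisTerm (ModularGroup.S • τ) p s = (τ : ℂ) ^ s * (eisTerm τ (rotatePair p) s +
      (exp (-(Real.pi * I * s)) - exp (Real.pi * I * s)) *
        if -rotatePair p ∈ wedgePairs then eisTerm τ (-rotatePair p) s else 0) := by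
  by_cases hp : p = (0, 0)
  · subst hp; simp [eisTerm, rotatePair, wedgePairs]
  set q := rotatePair p with hq
  have hq0 : q ≠ (0, 0) := by
    intro h
    have h2 : rotatePair p = rotatePair (0, 0) := by rw [← hq, h]; simp [rotatePair]
    exact hp (rotatePair.injective h2)
  have hpt : (p.1 : ℂ) * ((ModularGroup.S • τ : ℍ) : ℂ) + (p.2 : ℂ)
      = ((q.1 : ℂ) * (τ : ℂ) + (q.2 : ℂ)) / τ := by
    have := τ.ne_zero
    rw [UpperHalfPlane.modular_S_smul]
    simp only [hq, rotatePair, Equiv.coe_fn_mk]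
    push_cast
    field_simp
    ring
  rw [eisTerm, if_neg hp, hpt]
  by_cases hpos : q ∈ posPairs
  · obtain ⟨h, h0, h1⟩ := latticePt_pos τ hpos
    have hnw : -q ∉ wedgePairs := fun hw => ((neg_mem_posPairs hq0).1 (wedgePairs_subset hw)) hpos
    rw [if_neg hnw, branchPow_div h h0 h1, eisTerm_of_pos τ hpos]
    simp
  · obtain ⟨r, hr⟩ : ∃ r, q = -r := ⟨-q, by simp⟩
    have hrpos : r ∈ posPairs := by simpa [hr] using (neg_mem_posPairs hq0).2 hpos
    obtain ⟨h, h0, h1⟩ := latticePt_pos τ hrpos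
    have hneg : (q.1 : ℂ) * (τ : ℂ) + (q.2 : ℂ) = -((r.1 : ℂ) * (τ : ℂ) + (r.2 : ℂ)) := by
      simp [hr]; ring
    rw [hneg, branchPow_neg_div h h0 h1, hr, eisTerm_neg_of_pos τ hrpos]
    simp only [latticePt_div_im, neg_neg, eisTerm_of_pos τ hrpos]
    have hw : r ∈ wedgePairs ↔ 0 < r.2 := by
      simp only [posPairs, wedgePairs, Set.mem_ofPred_eq] at *
      omega
    by_cases h2 : 0 < r.2
    · rw [if_pos h2, if_pos (hw.2 h2)]
      simp only [one_mul, mul_neg]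
      ring
    · rw [if_neg h2, if_neg (fun h => h2 (hw.1 h))]
      simp only [neg_neg, one_mul, mul_neg, neg_mul, mul_zero, add_zero]
      ring

/-! ### Absolute convergence -/

lemma summable_norm_int_pair {k : ℝ} (hk : 2 < k) :
    Summable fun p : ℤ × ℤ => ‖![p.1, p.2]‖ ^ (-k) :=
  ((finTwoArrowEquiv ℤ).symm.summable_iff).2 (EisensteinSeries.summable_one_div_norm_rpow hk)

lemma summable_norm_eisTerm (τ : ℍ) {s : ℂ} (hs : 2 < s.re) :
    Summable fun p => ‖eisTerm τ p s‖ := by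
  refine Summable.of_nonneg_of_le (fun _ => norm_nonneg _) (fun p => ?_)
    ((summable_norm_int_pair hs).mul_left
      (Real.exp (Real.pi * |s.im|) * (EisensteinSeries.r τ) ^ (-s.re)))
  rw [eisTerm]
  split_ifs with hp
  · rw [norm_zero]
    have := EisensteinSeries.r_pos τ
    positivity
  have h1 := norm_branchPow_le (latticePt_ne_zero τ hp) (-s)
  have h2 := EisensteinSeries.summand_bound τ (by linarith : (0 : ℝ) ≤ s.re) ![p.1, p.2]
  simp only [Matrix.cons_val_zero, Matrix.cons_val_one] at h2
  rw [neg_im, abs_neg, neg_re] at h1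
  calc _ ≤ _ := h1
    _ ≤ Real.exp (Real.pi * |s.im|) * ((EisensteinSeries.r τ) ^ (-s.re) * ‖![p.1, p.2]‖ ^ (-s.re)) := by
        gcongr
    _ = _ := by ring

open MeasureTheory Set Filter Topology Asymptotics

/-! ### The Gamma integral along a ray -/

lemma norm_cpow_mul_exp {a r : ℂ} {t : ℝ} (ht : 0 < t) :
    ‖(t : ℂ) ^ (a - 1) * exp (-(r * t))‖ = t ^ (a.re - 1) * Real.exp (-(r.re * t)) := by
  rw [norm_mul, norm_cpow_eq_rpow_re_of_pos ht, norm_exp]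
  simp

lemma integrableOn_rpow_mul_exp {σ c : ℝ} (hσ : 0 < σ) (hc : 0 < c) :
    IntegrableOn (fun t : ℝ => t ^ (σ - 1) * Real.exp (-(c * t))) (Ioi 0) := by
  have := integrableOn_rpow_mul_exp_neg_mul_rpow (s := σ - 1) (p := 1) (b := c) (by linarith)
    one_pos hc
  simpa [neg_mul] using this

lemma continuousOn_cpow_mul_exp (a r : ℂ) :
    ContinuousOn (fun t : ℝ => (t : ℂ) ^ (a - 1) * exp (-(r * t))) (Ioi 0) := by
  intro t ht
  have h1 : ContinuousAt (fun t : ℝ => (t : ℂ) ^ (a - 1)) t :=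
    continuousAt_ofReal_cpow_const _ _ (Or.inr (ne_of_gt ht))
  exact (h1.mul (by fun_prop)).continuousWithinAt

lemma integrableOn_cpow_mul_exp {a r : ℂ} (ha : 0 < a.re) (hr : 0 < r.re) :
    IntegrableOn (fun t : ℝ => (t : ℂ) ^ (a - 1) * exp (-(r * t))) (Ioi 0) := by
  refine (integrable_norm_iff
    ((continuousOn_cpow_mul_exp a r).aestronglyMeasurable measurableSet_Ioi)).1 ?_
  refine (integrableOn_rpow_mul_exp ha hr).congr_fun (fun t ht => ?_) measurableSet_Ioi
  exact (norm_cpow_mul_exp ht).symm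

lemma integral_norm_cpow_mul_exp {a r : ℂ} (ha : 0 < a.re) (hr : 0 < r.re) :
    ∫ t in Ioi (0 : ℝ), ‖(t : ℂ) ^ (a - 1) * exp (-(r * t))‖ =
      r.re ^ (-a.re) * Real.Gamma a.re := by
  rw [setIntegral_congr_fun measurableSet_Ioi (fun t ht => norm_cpow_mul_exp ht),
    Real.integral_rpow_mul_exp_neg_mul_Ioi ha hr, one_div, Real.inv_rpow hr.le, Real.rpow_neg hr.le]

/-- The Gamma integral along a ray in the right half plane. -/
lemma integral_cpow_mul_exp {a r : ℂ} (ha : 0 < a.re) (hr : 0 < r.re) :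
    ∫ t in Ioi (0 : ℝ), (t : ℂ) ^ (a - 1) * exp (-(r * t)) = r ^ (-a) * Gamma a := by
  set U : Set ℂ := {z | 0 < z.re}
  have hU : IsOpen U := isOpen_lt continuous_const continuous_re
  have hconv : Convex ℝ U := convex_halfSpace_re_gt 0
  have h1 : AnalyticOnNhd ℂ (fun r : ℂ => ∫ t in Ioi (0 : ℝ), (t : ℂ) ^ (a - 1) * exp (-(r * t))) U := by
    refine DifferentiableOn.analyticOnNhd (fun r hr => ?_) hU
    have hr : 0 < r.re := hr
    have key := hasDerivAt_integral_of_dominated_loc_of_deriv_le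
      (μ := volume.restrict (Ioi (0 : ℝ))) (x₀ := r)
      (F := fun (r : ℂ) (t : ℝ) => (t : ℂ) ^ (a - 1) * exp (-(r * t)))
      (F' := fun (r : ℂ) (t : ℝ) => (t : ℂ) ^ (a - 1) * (exp (-(r * t)) * -(t : ℂ)))
      (bound := fun t => t ^ (a.re + 1 - 1) * Real.exp (-(r.re / 2 * t)))
      (s := Metric.ball r (r.re / 2)) (Metric.ball_mem_nhds r (by linarith)) ?_ ?_ ?_ ?_ ?_ ?_
    · exact key.2.differentiableAt.differentiableWithinAt
    · exact Eventually.of_forall fun r =>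
        (continuousOn_cpow_mul_exp a r).aestronglyMeasurable measurableSet_Ioi
    · exact integrableOn_cpow_mul_exp ha hr
    · have := (continuousOn_cpow_mul_exp a r).mul
        (Continuous.continuousOn (f := fun t : ℝ => -(t : ℂ)) (by fun_prop))
      exact (this.congr fun t _ => by simp [mul_assoc]).aestronglyMeasurable measurableSet_Ioi
    · refine (ae_restrict_iff' measurableSet_Ioi).2 (Eventually.of_forall fun t ht x hx => ?_)
      have ht : 0 < t := ht
      rw [← mul_assoc, norm_mul, norm_cpow_mul_exp ht, norm_neg, norm_real, Real.norm_of_nonneg ht.le]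
      have hre : r.re / 2 ≤ x.re := by
        have h1 := (abs_le.1 (abs_re_le_norm (x - r))).1
        have h2 := mem_ball_iff_norm.1 hx
        rw [sub_re] at h1; linarith
      have h3 : t ^ (a.re + 1 - 1) = t ^ (a.re - 1) * t := by
        rw [← Real.rpow_add_one ht.ne']; ring_nf
      rw [h3, mul_right_comm]
      gcongr
    · exact integrableOn_rpow_mul_exp (by linarith) (by linarith)
    · refine Eventually.of_forall fun t x _ => ?_
      have : HasDerivAt (fun x : ℂ => -(x * t)) (-(t : ℂ)) x := by
        simpa using ((hasDerivAt_id x).mul_const (t : ℂ)).fun_neg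
      exact (this.cexp).const_mul _
  have h2 : AnalyticOnNhd ℂ (fun r : ℂ => r ^ (-a) * Gamma a) U := by
    refine DifferentiableOn.analyticOnNhd (fun r hr => ?_) hU
    exact ((differentiableAt_id.cpow_const (Or.inl hr)).mul_const _).differentiableWithinAt
  -- Both sides are analytic in `r`, and for real `r > 0` this is the classical Gamma integral. The
  -- real points accumulate at `1`, so the identity theorem applies.
  refine h1.eqOn_of_preconnected_of_frequently_eq h2 hconv.isPreconnected
    (show (1 : ℂ) ∈ U by simp [U]) ?_ hr
  have ht : Tendsto (fun x : ℝ => (x : ℂ)) (𝓝[≠] 1) (𝓝[≠] 1) := by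
    refine tendsto_nhdsWithin_iff.2 ⟨?_, ?_⟩
    · exact (continuous_ofReal.tendsto' 1 1 (by simp)).mono_left nhdsWithin_le_nhds
    · filter_upwards [self_mem_nhdsWithin] with x hx
      simpa using hx
  refine ht.frequently (Eventually.frequently ?_)
  filter_upwards [nhdsWithin_le_nhds (lt_mem_nhds (zero_lt_one : (0 : ℝ) < 1))] with x hx
  rw [integral_cpow_mul_exp_neg_mul_Ioi ha hx, one_div, inv_cpow, cpow_neg]
  rw [arg_ofReal_of_nonneg hx.le]; exact Real.pi_pos.ne

/-! ### The Lipschitz summation formula -/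

/-- Multiplying by `-2 π i` lowers the argument of `w` from `(0, π)` to `(-π/2, π/2)`, so no branch
cut is crossed and the logarithms add. -/
lemma neg_two_pi_I_mul_cpow {w : ℂ} (hw : 0 < w.im) (s : ℂ) :
    (-(2 * Real.pi * I) * w) ^ s =
      exp (s * (Real.log (2 * Real.pi) - Real.pi / 2 * I)) * w ^ s := by
  have hw0 : w ≠ 0 := by rintro rfl; simp at hw
  have h0 : 0 ≤ w.arg := arg_nonneg_iff.2 hw.le
  have h1 : w.arg < Real.pi := arg_lt_pi_iff.2 (Or.inr hw.ne')
  have hpi := Real.pi_pos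
  have hexp : exp ((Real.log (2 * Real.pi) : ℂ) - Real.pi / 2 * I) = -(2 * Real.pi * I) := by
    rw [exp_sub, ← ofReal_exp, Real.exp_log (by positivity), exp_pi_div_two_mul_I, div_I]
    push_cast; ring
  have hlog : log (-(2 * Real.pi * I) * w)
      = ((Real.log (2 * Real.pi) : ℂ) - Real.pi / 2 * I) + log w := by
    have him : (((Real.log (2 * Real.pi) : ℂ) - Real.pi / 2 * I) + log w).im
        = w.arg - Real.pi / 2 := by
      have h2 : ((Real.pi : ℂ) / 2).re = Real.pi / 2 := by
        rw [← ofReal_ofNat, ← ofReal_div, ofReal_re]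
      rw [add_im, sub_im, ofReal_im, mul_I_im, h2, log_im]; ring
    rw [← log_exp (x := _ + _) (by rw [him]; linarith) (by rw [him]; linarith), exp_add, hexp,
      exp_log hw0]
  have hne : -(2 * Real.pi * I) * w ≠ 0 :=
    mul_ne_zero (by simp [Real.pi_ne_zero]) hw0
  rw [cpow_def_of_ne_zero hne, cpow_def_of_ne_zero hw0, hlog, ← exp_add]
  ring_nf

/-- The factor `(-2 π i) ^ s / Γ(s)` in the Lipschitz formula. -/
noncomputable def lipschitzFactor (s : ℂ) : ℂ :=
  exp (s * (Real.log (2 * Real.pi) - Real.pi / 2 * I)) * (Gamma s)⁻¹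

/-- Poisson summation for `x ^ (s - 1) exp (2 π i τ x)` on `x > 0`, extended by zero. Its Fourier
transform at `n` is the Gamma integral `Γ(s) (-2 π i (τ - n)) ^ (-s)`. -/
lemma lipschitz_formula (τ : ℍ) {s : ℂ} (hs : 2 < s.re) :
    HasSum (fun n : ℤ => ((τ : ℂ) + n) ^ (-s)) (lipschitzFactor s *
      ∑' r : ℕ, (((r + 1 : ℕ) : ℂ)) ^ (s - 1) * exp (2 * Real.pi * I * τ * (r + 1 : ℕ))) := by
  have hpi := Real.pi_pos
  have hGs : Gamma s ≠ 0 := Gamma_ne_zero_of_re_pos (by linarith)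
  have hs1 : s - 1 ≠ 0 := fun h => by
    have := congrArg Complex.re h; simp at this; linarith
  set r : ℂ := -(2 * Real.pi * I) * τ with hr
  have hrre : 0 < r.re := by
    have := τ.im_pos
    simp [hr]; positivity
  have hsum : Summable fun n : ℤ => ((τ : ℂ) + n) ^ (-s) := by
    have hinj : Function.Injective (fun n : ℤ => ((1 : ℤ), n)) := fun x y h => by simpa using h
    have := (summable_norm_eisTerm τ hs).of_norm.comp_injective hinj
    refine this.congr fun n => ?_
    rw [Function.comp, eisTerm_of_pos τ (by simp [posPairs])]
    simp
  -- Because `s ≠ 1`, `0 ^ (s - 1) = 0`; so `max x 0` extends the function by zero and keeps it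
  -- continuous, as Poisson summation requires.
  set f : ℝ → ℂ := fun x => ((max x 0 : ℝ) : ℂ) ^ (s - 1) * exp (-(r * x)) with hf
  have hf0 : ∀ x ≤ 0, f x = 0 := fun x hx => by
    simp [hf, max_eq_right hx, zero_cpow hs1]
  have hfpos : ∀ x > 0, f x = (x : ℂ) ^ (s - 1) * exp (-(r * x)) := fun x hx => by
    simp only [hf, max_eq_left (le_of_lt hx)]
  have hcont : Continuous f := by
    have h1 : Continuous fun x : ℝ => (x : ℂ) ^ (s - 1) :=
      continuous_ofReal_cpow_const (by simp; linarith)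
    exact (h1.comp (continuous_id.max continuous_const)).mul (by fun_prop)
  have hdecay : f =O[cocompact ℝ] fun x : ℝ => |x| ^ (-(2 : ℝ)) := by
    rw [cocompact_eq_atBot_atTop, isBigO_sup]
    constructor
    · have : f =ᶠ[atBot] fun _ => (0 : ℂ) := by
        filter_upwards [eventually_le_atBot 0] with x hx using hf0 x hx
      exact this.trans_isBigO (isBigO_zero _ _)
    · have h1 := (isLittleO_exp_neg_mul_rpow_atTop hrre (-2 - (s.re - 1))).isBigO
      have h2 := (isBigO_refl (fun x : ℝ => x ^ (s.re - 1)) atTop).mul h1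
      refine IsBigO.trans (IsBigO.of_norm_eventuallyLE ?_) (h2.congr' EventuallyEq.rfl ?_)
      · filter_upwards [eventually_gt_atTop 0] with x hx
        rw [hfpos x hx, norm_cpow_mul_exp hx, neg_mul]
      · filter_upwards [eventually_gt_atTop 0] with x hx
        rw [← Real.rpow_add hx, abs_of_pos hx]; ring_nf
  have hF : ∀ ξ : ℝ, FourierTransform.fourier f ξ = (r + 2 * Real.pi * I * ξ) ^ (-s) * Gamma s := by
    intro ξ
    rw [← integral_cpow_mul_exp (by linarith) (by simpa using hrre), Real.fourier_eq',
      ← integral_indicator measurableSet_Ioi]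
    congr 1
    ext x
    by_cases hx : 0 < x
    · rw [indicator_of_mem (mem_Ioi.2 hx), hfpos x hx, smul_eq_mul, mul_left_comm, ← exp_add]
      congr 2
      simp
      ring
    · rw [indicator_of_notMem (by simpa using hx), hf0 x (not_lt.1 hx), smul_zero]
  have hFn : ∀ n : ℤ, FourierTransform.fourier f (n : ℝ)
      = exp (-s * (Real.log (2 * Real.pi) - Real.pi / 2 * I)) * Gamma s *
        ((τ : ℂ) + (-n : ℤ)) ^ (-s) := by
    intro n
    rw [hF]
    have : r + 2 * Real.pi * I * (n : ℝ) = -(2 * Real.pi * I) * ((τ : ℂ) + (-n : ℤ)) := by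
      rw [hr]; push_cast; ring
    rw [this, neg_two_pi_I_mul_cpow (by simpa using τ.im_pos)]
    ring
  have hsum' : Summable fun n : ℤ => ((τ : ℂ) + (-n : ℤ)) ^ (-s) :=
    (Equiv.neg ℤ).summable_iff.2 hsum
  have hP := Real.tsum_eq_tsum_fourier_of_rpow_decay_of_summable hcont one_lt_two hdecay
    (by simp only [hFn]; exact hsum'.mul_left _) 0
  simp only [zero_add, hFn, QuotientAddGroup.mk_zero, fourier_eval_zero, mul_one] at hP
  have hneg : ∑' n : ℤ, ((τ : ℂ) + (-n : ℤ)) ^ (-s) = ∑' n : ℤ, ((τ : ℂ) + n) ^ (-s) :=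
    (Equiv.neg ℤ).tsum_eq (fun n : ℤ => ((τ : ℂ) + n) ^ (-s))
  rw [tsum_mul_left, hneg] at hP
  have hleft : ∑' n : ℤ, f n = ∑' r : ℕ, (((r + 1 : ℕ) : ℂ)) ^ (s - 1) *
      exp (2 * Real.pi * I * τ * (r + 1 : ℕ)) := by
    have hinj : Function.Injective (fun m : ℕ => ((m + 1 : ℕ) : ℤ)) := fun x y h => by simpa using h
    rw [← hinj.tsum_eq]
    · refine tsum_congr fun m => ?_
      rw [hfpos _ (by push_cast; positivity)]
      push_cast
      rw [hr]
      congr 2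
      ring
    · intro n hn
      have : 0 < n := by
        by_contra hc
        exact hn (hf0 _ (by exact_mod_cast not_lt.1 hc))
      exact ⟨n.toNat - 1, by simp; omega⟩
  convert hsum.hasSum using 1
  rw [← hleft, hP, lipschitzFactor, neg_mul, exp_neg]
  have := exp_ne_zero (s * (Real.log (2 * Real.pi) - Real.pi / 2 * I))
  field_simp

/-! ### Uniqueness of the entire continuation -/

lemma IsEntireContinuation.eq {ι : Type} {u : ι → ℂ → ℂ} {F₁ F₂ : ℂ → ℂ}
    (h₁ : IsEntireContinuation u F₁) (h₂ : IsEntireContinuation u F₂) : F₁ = F₂ := by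
  have a₁ : AnalyticOnNhd ℂ F₁ univ := h₁.1.differentiableOn.analyticOnNhd isOpen_univ
  have a₂ : AnalyticOnNhd ℂ F₂ univ := h₂.1.differentiableOn.analyticOnNhd isOpen_univ
  refine a₁.eq_of_eventuallyEq a₂ (z₀ := 3) ?_
  filter_upwards [(isOpen_lt continuous_const Complex.continuous_re).mem_nhds
    (show (2 : ℝ) < (3 : ℂ).re by norm_num)] with s hs
  exact (h₁.2 s hs).unique (h₂.2 s hs)

lemma IsEntireContinuation.entireContinuation_eq {ι : Type} {u : ι → ℂ → ℂ} {F : ℂ → ℂ}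
    (h : IsEntireContinuation u F) : entireContinuation u = F := by
  have hex : ∃ F, IsEntireContinuation u F := ⟨F, h⟩
  rw [entireContinuation, dif_pos hex]
  exact hex.choose_spec.eq h

/-! ### The double exponential series -/

/-- The parameters of the two families of lattice points `(m, n)`, `m ≡ n ≡ a` modulo `N`, to
which the Lipschitz formula is applied: all points, and the points with odd coordinates. -/
def IsLatticeType (N : ℕ) (a : ℤ) : Prop := N = 1 ∧ a = 0 ∨ N = 2 ∧ a = 1

lemma IsLatticeType.pos {N : ℕ} {a : ℤ} (h : IsLatticeType N a) : 1 ≤ N := by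
  rcases h with h | h <;> omega

/-- The term `r ^ (s - 1) exp (2 π i r ((N m + 1) z + a) / N)`, with `r` shifted by one. -/
noncomputable def qTerm (N : ℕ) (a : ℤ) (z : ℂ) (p : ℕ × ℕ) (s : ℂ) : ℂ :=
  ((p.2 + 1 : ℕ) : ℂ) ^ (s - 1) *
    exp (2 * Real.pi * I * (((N * p.1 + 1 : ℕ) * z + a) / N) * (p.2 + 1 : ℕ))

/-- The double exponential series on the right of the Lipschitz formula. -/
noncomputable def qSeries (N : ℕ) (a : ℤ) (z s : ℂ) : ℂ := ∑' p : ℕ × ℕ, qTerm N a z p s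

/-- A majorant for `qTerm`. -/
noncomputable def qBound (R : ℕ) (c : ℝ) (p : ℕ × ℕ) : ℝ :=
  Real.exp (-c * p.1) * (((p.2 + 1 : ℕ) : ℝ) ^ R * Real.exp (-c * (p.2 + 1 : ℕ)))

lemma summable_qBound (R : ℕ) {c : ℝ} (hc : 0 < c) : Summable (qBound R c) := by
  have h1 : Summable fun m : ℕ => Real.exp (-c * m) := by
    simpa using Real.summable_pow_mul_exp_neg_nat_mul 0 hc
  have h2 : Summable fun r : ℕ => (((r + 1 : ℕ) : ℝ) ^ R * Real.exp (-c * (r + 1 : ℕ))) :=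
    (summable_nat_add_iff (f := fun r : ℕ => (r : ℝ) ^ R * Real.exp (-c * r)) 1).2
      (Real.summable_pow_mul_exp_neg_nat_mul R hc)
  exact h1.mul_of_nonneg h2 (fun _ => by positivity) (fun _ => by positivity)

/-- The exponent `(N m + 1) (r + 1)` is at least `m + (r + 1)`, which bounds the double series by a
product of two convergent single series, uniformly for `Im z ≥ δ` and `Re s ≤ R + 1`. -/
lemma norm_qTerm_le {N : ℕ} (hN : 1 ≤ N) (a : ℤ) {z s : ℂ} {δ : ℝ} {R : ℕ} (hδ : 0 < δ)
    (hz : δ ≤ z.im) (hs : s.re - 1 ≤ R) (p : ℕ × ℕ) :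
    ‖qTerm N a z p s‖ ≤ qBound R (2 * Real.pi * δ / N) p := by
  obtain ⟨m, r⟩ := p
  have hN0 : (0 : ℝ) < N := by exact_mod_cast hN
  have hre : (2 * Real.pi * I * (((N * m + 1 : ℕ) * z + a) / N) * (r + 1 : ℕ)).re
      = -(2 * Real.pi / N * ((N * m + 1) * (r + 1)) * z.im) := by
    have : (2 * Real.pi * I * (((N * m + 1 : ℕ) * z + a) / N) * (r + 1 : ℕ))
        = ((2 * Real.pi / N * ((N * m + 1) * (r + 1)) : ℝ) : ℂ) * z * I +
          ((2 * Real.pi * a / N * (r + 1) : ℝ) : ℂ) * I := by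
      push_cast
      field_simp
    rw [this, add_re, mul_I_re, mul_I_re, ofReal_im, neg_zero, add_zero, im_ofReal_mul]
  rw [qTerm, norm_mul, norm_natCast_cpow_of_pos (Nat.succ_pos r), norm_exp, hre, qBound]
  have h1 : (1 : ℝ) ≤ ((r + 1 : ℕ) : ℝ) := by exact_mod_cast Nat.succ_pos r
  have h2 : ((r + 1 : ℕ) : ℝ) ^ (s - 1).re ≤ ((r + 1 : ℕ) : ℝ) ^ R := by
    rw [← Real.rpow_natCast]
    exact Real.rpow_le_rpow_of_exponent_le h1 (by simpa using hs)
  have h3 : (m + (r + 1 : ℕ) : ℝ) ≤ (N * m + 1) * (r + 1) := by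
    have hN1 : (1 : ℝ) ≤ N := by exact_mod_cast hN
    have hm : (m : ℝ) ≤ N * m := le_mul_of_one_le_left (Nat.cast_nonneg m) hN1
    have hr : (0 : ℝ) ≤ N * m * r := by positivity
    push_cast
    nlinarith
  rw [mul_left_comm (Real.exp _), ← Real.exp_add]
  have h4 : -(2 * Real.pi / N * ((N * m + 1) * (r + 1)) * z.im)
      ≤ -(2 * Real.pi * δ / N) * m + -(2 * Real.pi * δ / N) * (r + 1 : ℕ) := by
    have h5 : (2 * Real.pi / N * (m + (r + 1 : ℕ))) * δ
        ≤ 2 * Real.pi / N * ((N * m + 1) * (r + 1)) * z.im := by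
      gcongr
    have h6 : (2 * Real.pi / N * (m + (r + 1 : ℕ))) * δ
        = 2 * Real.pi * δ / N * m + 2 * Real.pi * δ / N * (r + 1 : ℕ) := by ring
    rw [h6] at h5
    linarith
  gcongr

lemma summable_qTerm {N : ℕ} (hN : 1 ≤ N) (a : ℤ) {z : ℂ} (hz : 0 < z.im) (s : ℂ) :
    Summable fun p => qTerm N a z p s := by
  obtain ⟨R, hR⟩ := exists_nat_ge (s.re - 1)
  have hN0 : (0 : ℝ) < N := by exact_mod_cast hN
  exact (summable_qBound R (c := 2 * Real.pi * z.im / N) (by positivity)).of_norm_bounded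
    (fun p => norm_qTerm_le hN a hz le_rfl hR p)

lemma differentiable_qSeries {N : ℕ} (hN : 1 ≤ N) (a : ℤ) {z : ℂ} (hz : 0 < z.im) :
    Differentiable ℂ (qSeries N a z) := by
  intro s
  obtain ⟨R, hR⟩ := exists_nat_gt (s.re - 1)
  have hN0 : (0 : ℝ) < N := by exact_mod_cast hN
  have hU : IsOpen {s : ℂ | s.re - 1 < R} :=
    isOpen_lt (Complex.continuous_re.sub continuous_const) continuous_const
  refine (differentiableOn_tsum_of_summable_norm
    (summable_qBound R (c := 2 * Real.pi * z.im / N) (by positivity)) (fun p => ?_) hU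
    (fun p w hw => norm_qTerm_le hN a hz le_rfl (le_of_lt hw) p)).differentiableAt (hU.mem_nhds hR)
  have h0 : ((p.2 + 1 : ℕ) : ℂ) ≠ 0 := Nat.cast_ne_zero.2 (Nat.succ_ne_zero _)
  intro w _
  exact (((differentiableAt_id.sub_const 1).const_cpow (Or.inl h0)).mul_const _).differentiableWithinAt

lemma differentiableOn_qSeries {N : ℕ} (hN : 1 ≤ N) (a : ℤ) (s : ℂ) :
    DifferentiableOn ℂ (fun z => qSeries N a z s) {z | 0 < z.im} := by
  intro z hz
  have hz : 0 < z.im := hz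
  obtain ⟨R, hR⟩ := exists_nat_ge (s.re - 1)
  have hN0 : (0 : ℝ) < N := by exact_mod_cast hN
  have hU : IsOpen {w : ℂ | z.im / 2 < w.im} := isOpen_lt continuous_const Complex.continuous_im
  refine ((differentiableOn_tsum_of_summable_norm
    (summable_qBound R (c := 2 * Real.pi * (z.im / 2) / N) (by positivity)) (fun p => ?_) hU
    (fun p w hw => norm_qTerm_le hN a (by linarith) (le_of_lt hw) hR p)).differentiableAt
    (hU.mem_nhds (show z.im / 2 < z.im by linarith))).differentiableWithinAt
  unfold qTerm
  fun_prop

/-! ### The sum over the upper half of the lattice -/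

lemma natCast_mul_cpow {N : ℕ} (hN : 1 ≤ N) {w : ℂ} (hw : w ≠ 0) (s : ℂ) :
    ((N : ℂ) * w) ^ s = (N : ℂ) ^ s * w ^ s := by
  have hN0 : (0 : ℝ) < N := by exact_mod_cast hN
  have hN1 : (N : ℂ) ≠ 0 := by exact_mod_cast hN0.ne'
  have := log_ofReal_mul hN0 hw
  rw [ofReal_natCast] at this
  rw [cpow_def_of_ne_zero (mul_ne_zero hN1 hw), cpow_def_of_ne_zero hN1, cpow_def_of_ne_zero hw,
    this, ← exp_add, ← natCast_log]
  ring_nf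

/-- Factoring `N` out of a row leaves a sum over all integer translates of `((N m + 1) τ + a) / N`,
to which the Lipschitz formula applies. -/
lemma hasSum_upper_rows {N : ℕ} (hN : 1 ≤ N) (a : ℤ) (τ : ℍ) {s : ℂ} (hs : 2 < s.re) :
    HasSum (fun p : ℕ × ℤ => (((N * p.1 + 1 : ℕ) : ℂ) * τ + (N * p.2 + a : ℤ)) ^ (-s))
      (lipschitzFactor s * (N : ℂ) ^ (-s) * qSeries N a τ s) := by
  have hN0 : (0 : ℝ) < N := by exact_mod_cast hN
  have hN1 : (N : ℂ) ≠ 0 := by exact_mod_cast hN0.ne'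
  have hinj : Function.Injective
      (fun p : ℕ × ℤ => (((N * p.1 + 1 : ℕ) : ℤ), (N * p.2 + a : ℤ))) := by
    rintro ⟨m, n⟩ ⟨m', n'⟩ h
    have hN2 : (N : ℤ) ≠ 0 := by exact_mod_cast hN0.ne'
    simpa [hN2, show N ≠ 0 by omega] using h
  have hsum : Summable fun p : ℕ × ℤ =>
      (((N * p.1 + 1 : ℕ) : ℂ) * τ + (N * p.2 + a : ℤ)) ^ (-s) := by
    refine ((summable_norm_eisTerm τ hs).of_norm.comp_injective hinj).congr fun p => ?_
    rw [Function.comp, eisTerm_of_pos τ (Or.inl (by dsimp only; positivity))]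
    push_cast
    rfl
  have hq := summable_qTerm hN a τ.im_pos s
  convert hsum.hasSum using 1
  rw [hsum.tsum_prod, qSeries, hq.tsum_prod, ← tsum_mul_left]
  refine tsum_congr fun m => ?_
  have him : 0 < ((((N * m + 1 : ℕ) : ℂ) * τ + a) / N).im := by
    have : (((N * m + 1 : ℕ) : ℂ) * τ + a) / N
        = (((N * m + 1) / N : ℝ) : ℂ) * τ + ((a / N : ℝ) : ℂ) := by
      push_cast; field_simp
    rw [this, add_im, ofReal_im, add_zero, im_ofReal_mul]
    have := τ.im_pos
    positivity
  have hL := (lipschitz_formula ⟨_, him⟩ hs).tsum_eq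
  have hterm : ∀ n : ℤ, (((N * m + 1 : ℕ) : ℂ) * τ + (N * n + a : ℤ)) ^ (-s)
      = (N : ℂ) ^ (-s) * ((((N * m + 1 : ℕ) : ℂ) * τ + a) / N + n) ^ (-s) := by
    intro n
    rw [← natCast_mul_cpow hN]
    · congr 1
      push_cast; field_simp; ring
    · intro h0
      have := congrArg Complex.im h0
      rw [add_im, intCast_im, add_zero, zero_im] at this
      exact him.ne' this
  simp only [hterm, tsum_mul_left]
  simp only at hL
  rw [hL]
  simp only [qTerm]
  ring

/-- The contribution of the row `m = 0`. -/
noncomputable def axisPart (N : ℕ) (s : ℂ) : ℂ := if N = 1 then riemannZeta s else 0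

/-- The sum over the pairs with `m τ + n` in the upper half plane or on the positive real axis. -/
noncomputable def upperSum (N : ℕ) (a : ℤ) (τ : ℂ) (s : ℂ) : ℂ :=
  axisPart N s + lipschitzFactor s * (N : ℂ) ^ (-s) * qSeries N a τ s

-- The rows above the real axis give the exponential series and the positive half of the row `m = 0`
-- gives `ζ`. With odd coordinates the row `m = 0` is empty.
open Classical in
lemma hasSum_upper {N : ℕ} {a : ℤ} (h : IsLatticeType N a) (τ : ℍ) {s : ℂ} (hs : 2 < s.re) :
    HasSum (fun p => if p ∈ posPairs then eisTermMod N a a τ p s else 0) (upperSum N a τ s) := by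
  have hrows : HasSum (fun p : ℤ × ℤ => if 0 < p.1 then eisTermMod N a a τ p s else 0)
      (lipschitzFactor s * (N : ℂ) ^ (-s) * qSeries N a τ s) := by
    have hN0 : (N : ℤ) ≠ 0 := by have := h.pos; omega
    have hinj : Function.Injective
        (fun p : ℕ × ℤ => (((N * p.1 + 1 : ℕ) : ℤ), (N * p.2 + a : ℤ))) := by
      rintro ⟨m, n⟩ ⟨m', n'⟩ h'
      simpa [hN0, show N ≠ 0 by have := h.pos; omega] using h'
    refine (hinj.hasSum_iff ?_).1 ((hasSum_upper_rows h.pos a τ hs).congr_fun fun p => ?_)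
    · rintro ⟨m, n⟩ hp
      rw [ite_eq_right_iff]
      intro hm
      rw [eisTermMod, if_neg]
      rintro ⟨h1, h2⟩
      apply hp
      simp only [Int.ModEq] at h1 h2
      simp only [mem_range, Prod.mk.injEq, Prod.exists] at *
      rcases h with ⟨rfl, rfl⟩ | ⟨rfl, rfl⟩
      · exact ⟨(m - 1).toNat, n, by push_cast; omega, by push_cast; omega⟩
      · exact ⟨((m - 1) / 2).toNat, (n - 1) / 2, by push_cast; omega, by push_cast; omega⟩
    · have hpos : (0 : ℤ) < ((N * p.1 + 1 : ℕ) : ℤ) := by positivity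
      rw [Function.comp]
      dsimp only
      rw [if_pos hpos, eisTermMod, if_pos, eisTerm_of_pos τ (Or.inl hpos)]
      · push_cast; rfl
      · simp only [Int.ModEq]
        rcases h with ⟨rfl, rfl⟩ | ⟨rfl, rfl⟩ <;> push_cast <;> omega
  have haxis : HasSum (fun p : ℤ × ℤ => if p.1 = 0 ∧ 0 < p.2 then eisTermMod N a a τ p s else 0)
      (axisPart N s) := by
    rcases h with ⟨rfl, rfl⟩ | ⟨rfl, rfl⟩
    · have hinj : Function.Injective (fun n : ℕ => ((0 : ℤ), ((n + 1 : ℕ) : ℤ))) := fun x y h => by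
        simpa using h
      refine (hinj.hasSum_iff ?_).1 ?_
      · rintro ⟨m, n⟩ hp
        rw [ite_eq_right_iff]
        rintro ⟨h1, h2⟩
        exact absurd ⟨(n - 1).toNat, by simp at h1 h2 ⊢; omega⟩ hp
      · have hterm : (fun p : ℤ × ℤ => if p.1 = 0 ∧ 0 < p.2 then eisTermMod 1 0 0 τ p s else 0) ∘
            (fun n : ℕ => ((0 : ℤ), ((n + 1 : ℕ) : ℤ))) = fun n : ℕ => 1 / ((n : ℂ) + 1) ^ s := by
          ext n
          have hpos : (0 : ℤ) < ((n + 1 : ℕ) : ℤ) := by positivity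
          rw [Function.comp]
          dsimp only
          rw [if_pos ⟨rfl, hpos⟩, eisTermMod, if_pos (by simp [Int.modEq_one]),
            eisTerm_of_pos τ (Or.inr ⟨rfl, hpos⟩)]
          simp [cpow_neg]
        rw [hterm, axisPart, if_pos rfl, zeta_eq_tsum_one_div_nat_add_one_cpow (by linarith)]
        have := (summable_nat_add_iff (f := fun n : ℕ => 1 / (n : ℂ) ^ s) 1).2
          (summable_one_div_nat_cpow.2 (by linarith))
        push_cast at this
        exact this.hasSum
    · rw [axisPart, if_neg (by norm_num)]
      convert hasSum_zero using 1
      ext p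
      rw [ite_eq_right_iff]
      rintro ⟨h1, -⟩
      rw [eisTermMod, if_neg]
      rintro ⟨h2, -⟩
      rw [h1] at h2
      simp [Int.ModEq] at h2
  refine (haxis.add hrows).congr_fun fun p => ?_
  simp only [posPairs, mem_ofPred_eq]
  by_cases h1 : 0 < p.1
  · simp [h1, h1.ne']
  · by_cases h2 : p.1 = 0 ∧ 0 < p.2
    · simp [h2]
    · simp [h1, h2]

/-! ### The entire continuation -/

lemma eisTermMod_neg_of_pos {N : ℕ} {a : ℤ} (h : IsLatticeType N a) (τ : ℍ) {p : ℤ × ℤ}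
    (hp : p ∈ posPairs) (s : ℂ) :
    eisTermMod N a a τ (-p) s = exp (Real.pi * I * s) * eisTermMod N a a τ p s := by
  have : ((-p).1 ≡ a [ZMOD (N : ℤ)] ∧ (-p).2 ≡ a [ZMOD (N : ℤ)]) ↔
      (p.1 ≡ a [ZMOD (N : ℤ)] ∧ p.2 ≡ a [ZMOD (N : ℤ)]) := by
    simp only [Int.ModEq, Prod.fst_neg, Prod.snd_neg]
    rcases h with ⟨rfl, rfl⟩ | ⟨rfl, rfl⟩ <;> push_cast <;> omega
  simp only [eisTermMod, this, eisTerm_neg_of_pos τ hp]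
  split_ifs <;> simp

/-- Both lattice types are stable under negation, so the lower half repeats the upper half with the
factor `exp (π i s)`. -/
lemma hasSum_eisTermMod {N : ℕ} {a : ℤ} (h : IsLatticeType N a) (τ : ℍ) {s : ℂ} (hs : 2 < s.re) :
    HasSum (fun p => eisTermMod N a a τ p s)
      ((1 + exp (Real.pi * I * s)) * upperSum N a τ s) := by
  classical
  have h1 := hasSum_upper h τ hs
  have h2 := ((Equiv.neg (ℤ × ℤ)).hasSum_iff.2 h1).mul_left (exp (Real.pi * I * s))
  rw [one_add_mul]
  refine (h1.add h2).congr_fun fun p => ?_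
  simp only [Function.comp, Equiv.neg_apply]
  by_cases hp0 : p = (0, 0)
  · subst hp0
    simp [posPairs, eisTermMod, eisTerm]
  by_cases hp : p ∈ posPairs
  · rw [if_pos hp, if_neg fun h' => (neg_mem_posPairs hp0).1 h' hp]
    simp
  · have hp' := (neg_mem_posPairs hp0).2 hp
    rw [if_neg hp, if_pos hp', ← eisTermMod_neg_of_pos h τ hp', neg_neg, zero_add]

/-- The entire function `(1 + exp (π i s)) ζ(s)` for `N = 1`. -/
noncomputable def axisEntire (N : ℕ) (s : ℂ) : ℂ :=
  if N = 1 then Function.update (fun s => (1 + exp (Real.pi * I * s)) * riemannZeta s) 1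
    (-(Real.pi * I)) s else 0

lemma axisEntire_of_ne {N : ℕ} {s : ℂ} (hs : s ≠ 1) :
    axisEntire N s = (1 + exp (Real.pi * I * s)) * axisPart N s := by
  rw [axisEntire, axisPart]
  split_ifs
  · rw [Function.update_of_ne hs]
  · simp

lemma hasDerivAt_one_add_exp (s : ℂ) :
    HasDerivAt (fun s : ℂ => 1 + exp (Real.pi * I * s)) (exp (Real.pi * I * s) * (Real.pi * I)) s := by
  have := ((hasDerivAt_id s).const_mul ((Real.pi : ℂ) * I)).cexp.const_add 1
  simpa using this

lemma differentiable_axisEntire (N : ℕ) : Differentiable ℂ (axisEntire N) := by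
  by_cases hN : N = 1
  swap
  · have : axisEntire N = fun _ => 0 := by ext s; simp [axisEntire, hN]
    rw [this]; exact differentiable_const 0
  have heq : axisEntire N = Function.update
      (fun s => (1 + exp (Real.pi * I * s)) * riemannZeta s) 1 (-(Real.pi * I)) := by
    ext s; simp [axisEntire, hN]
  have hd : ∀ s : ℂ, s ≠ 1 → DifferentiableAt ℂ (axisEntire N) s := by
    intro s hs
    have h1 : DifferentiableAt ℂ (fun s => (1 + exp (Real.pi * I * s)) * riemannZeta s) s :=
      (hasDerivAt_one_add_exp s).differentiableAt.mul (differentiableAt_riemannZeta hs)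
    refine h1.congr_of_eventuallyEq ?_
    filter_upwards [isOpen_ne.mem_nhds hs] with z hz
    rw [heq, Function.update_of_ne hz]
  intro s
  by_cases hs : s = 1
  swap
  · exact hd s hs
  subst hs
  refine (analyticAt_of_differentiable_on_punctured_nhds_of_continuousAt ?_ ?_).differentiableAt
  · filter_upwards [self_mem_nhdsWithin] with z hz using hd z hz
  · rw [heq, continuousAt_update_same]
    -- Near `1` the product is the difference quotient of `1 + exp (π i s)` times `(s - 1) ζ(s)`;
    -- its limit `-π i` is the value inserted in `axisEntire`.
    have h1 := (hasDerivAt_one_add_exp 1).tendsto_slope.mul riemannZeta_residue_one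
    have h2 : exp (Real.pi * I * 1) * (Real.pi * I) * 1 = -(Real.pi * I) := by
      rw [mul_one, mul_one, exp_pi_mul_I]; ring
    rw [h2] at h1
    refine h1.congr' ?_
    filter_upwards [self_mem_nhdsWithin] with z hz
    have hz : z - 1 ≠ 0 := sub_ne_zero.2 hz
    rw [slope_def_field, mul_one, exp_pi_mul_I]
    field_simp
    ring

lemma differentiable_lipschitzFactor : Differentiable ℂ lipschitzFactor := by
  have h : Differentiable ℂ fun s : ℂ => exp (s * (Real.log (2 * Real.pi) - Real.pi / 2 * I)) := by
    fun_prop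
  exact h.mul differentiable_one_div_Gamma

lemma lipschitzFactor_neg_nat (n : ℕ) : lipschitzFactor (-n) = 0 := by
  rw [lipschitzFactor, Gamma_neg_nat_eq_zero, inv_zero, mul_zero]

/-- The coefficient of the double exponential series in the Eisenstein series. -/
noncomputable def qFactor (N : ℕ) (s : ℂ) : ℂ :=
  (1 + exp (Real.pi * I * s)) * (lipschitzFactor s * (N : ℂ) ^ (-s))

lemma differentiable_natCast_cpow_neg {N : ℕ} (hN : 1 ≤ N) :
    Differentiable ℂ fun s : ℂ => (N : ℂ) ^ (-s) := fun s =>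
  differentiableAt_id.neg.const_cpow (Or.inl (Nat.cast_ne_zero.2 (by omega)))

lemma differentiable_qFactor {N : ℕ} (hN : 1 ≤ N) : Differentiable ℂ (qFactor N) := fun s =>
  (hasDerivAt_one_add_exp s).differentiableAt.mul
    ((differentiable_lipschitzFactor s).mul (differentiable_natCast_cpow_neg hN s))

/-- The entire continuation of the Eisenstein series. -/
noncomputable def eisEntire (N : ℕ) (a : ℤ) (τ s : ℂ) : ℂ :=
  axisEntire N s + qFactor N s * qSeries N a τ s

lemma eisEntire_of_ne {N : ℕ} {a : ℤ} {τ s : ℂ} (hs : s ≠ 1) :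
    eisEntire N a τ s = (1 + exp (Real.pi * I * s)) * upperSum N a τ s := by
  rw [eisEntire, axisEntire_of_ne hs, qFactor, upperSum]
  ring

lemma isEntireContinuation_eisEntire {N : ℕ} {a : ℤ} (h : IsLatticeType N a) (τ : ℍ) :
    IsEntireContinuation (eisTermMod N a a τ) (eisEntire N a τ) := by
  refine ⟨fun s => ?_, fun s hs => ?_⟩
  · exact (differentiable_axisEntire N s).add ((differentiable_qFactor h.pos s).mul
      (differentiable_qSeries h.pos a τ.im_pos s))
  · rw [eisEntire_of_ne]
    · exact hasSum_eisTermMod h τ hs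
    · rintro rfl; norm_num at hs

lemma neg_two_mul_ne_one (k : ℕ) : (-2 * k : ℂ) ≠ 1 := by
  intro h
  have := congrArg Complex.re h
  simp at this
  linarith [(Nat.cast_nonneg k : (0 : ℝ) ≤ k)]

lemma lipschitzFactor_neg_two_mul (k : ℕ) : lipschitzFactor (-2 * k) = 0 := by
  have := lipschitzFactor_neg_nat (2 * k)
  push_cast at this
  rwa [← neg_mul] at this

lemma axisPart_neg_two_mul {k : ℕ} (hk : 1 ≤ k) (N : ℕ) : axisPart N (-2 * k) = 0 := by
  obtain ⟨n, rfl⟩ : ∃ n, k = n + 1 := ⟨k - 1, by omega⟩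
  rw [axisPart]
  split_ifs
  · exact_mod_cast riemannZeta_neg_two_mul_nat_add_one n
  · rfl

/-- The trivial zeros of `ζ` meet the zeros of `1 / Γ`. Here `k ≥ 1` matters, since `ζ(0) ≠ 0`. -/
lemma upperSum_neg_two_mul {k : ℕ} (hk : 1 ≤ k) (N : ℕ) (a : ℤ) (τ : ℂ) :
    upperSum N a τ (-2 * k) = 0 := by
  rw [upperSum, axisPart_neg_two_mul hk, lipschitzFactor_neg_two_mul]
  ring

lemma eisEntire_neg_two_mul {k : ℕ} (hk : 1 ≤ k) (N : ℕ) (a : ℤ) (τ : ℂ) :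
    eisEntire N a τ (-2 * k) = 0 := by
  rw [eisEntire_of_ne (neg_two_mul_ne_one k), upperSum_neg_two_mul hk, mul_zero]

lemma analyticAt_upperSum {N : ℕ} (hN : 1 ≤ N) (a : ℤ) (τ : ℍ) {s : ℂ} (hs : s ≠ 1) :
    AnalyticAt ℂ (upperSum N a τ) s := by
  refine DifferentiableOn.analyticAt (s := {1}ᶜ) (fun s hs => ?_) (isOpen_ne.mem_nhds hs)
  refine (DifferentiableAt.add ?_ (((differentiable_lipschitzFactor s).mul
    (differentiable_natCast_cpow_neg hN s)).mul
    (differentiable_qSeries hN a τ.im_pos s))).differentiableWithinAt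
  by_cases h1 : N = 1
  · have : axisPart N = riemannZeta := by ext s; simp [axisPart, h1]
    rw [this]
    exact differentiableAt_riemannZeta hs
  · have : axisPart N = fun _ => 0 := by ext s; simp [axisPart, h1]
    rw [this]
    exact differentiableAt_const 0

/-- The derivative of the Eisenstein series at `s = -2 k`. -/
noncomputable def eisDeriv (N : ℕ) (a : ℤ) (k : ℕ) (τ : ℂ) : ℂ :=
  deriv (axisEntire N) (-2 * k) + deriv (qFactor N) (-2 * k) * qSeries N a τ (-2 * k)

/-- Since `qFactor` vanishes at `-2 k`, the `s`-derivative of the exponential series drops out and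
only its value at `-2 k` survives. -/
lemma hasDerivAt_eisEntire {N : ℕ} (hN : 1 ≤ N) (a : ℤ) (k : ℕ) (τ : ℍ) :
    HasDerivAt (eisEntire N a τ) (eisDeriv N a k τ) (-2 * k) := by
  have h0 : qFactor N (-2 * k) = 0 := by
    rw [qFactor, lipschitzFactor_neg_two_mul]; ring
  have := (differentiable_axisEntire N (-2 * k)).hasDerivAt.add
    ((differentiable_qFactor hN (-2 * k)).hasDerivAt.mul
      (differentiable_qSeries hN a τ.im_pos (-2 * k)).hasDerivAt)
  rw [h0, zero_mul, add_zero] at this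
  exact this

/-! ### The generating function of an arithmetic progression -/

/-- The sum of the geometric series `∑ m, exp (-(N m + a) z)`. -/
noncomputable def geomExp (N : ℕ) (a : ℤ) (z : ℂ) : ℂ := exp (-(a * z)) / (1 - exp (-(N * z)))

lemma norm_exp_neg_natCast_mul_lt_one {N : ℕ} (hN : 1 ≤ N) {z : ℂ} (hz : 0 < z.re) :
    ‖exp (-(N * z))‖ < 1 := by
  have hN0 : (0 : ℝ) < N := by exact_mod_cast hN
  rw [norm_exp, Real.exp_lt_one_iff]
  simpa using mul_pos hN0 hz

lemma one_sub_exp_ne_zero {N : ℕ} (hN : 1 ≤ N) {z : ℂ} (hz : 0 < z.re) :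
    1 - exp (-(N * z)) ≠ 0 := by
  intro h
  have := norm_exp_neg_natCast_mul_lt_one hN hz
  rw [← sub_eq_zero.1 h, norm_one] at this
  exact lt_irrefl _ this

lemma geomExp_term (N : ℕ) (a : ℤ) (z : ℂ) (m : ℕ) :
    exp (-((N * m + a : ℤ) * z)) = exp (-(a * z)) * exp (-(N * z)) ^ m := by
  rw [← exp_nat_mul, ← exp_add]
  congr 1; push_cast; ring

lemma hasSum_geomExp {N : ℕ} (hN : 1 ≤ N) (a : ℤ) {z : ℂ} (hz : 0 < z.re) :
    HasSum (fun m : ℕ => exp (-((N * m + a : ℤ) * z))) (geomExp N a z) := by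
  simp only [geomExp_term, geomExp, div_eq_mul_inv]
  exact (hasSum_geometric_of_norm_lt_one (norm_exp_neg_natCast_mul_lt_one hN hz)).mul_left _

lemma summable_norm_geomExp {N : ℕ} (hN : 1 ≤ N) (a : ℤ) {z : ℂ} (hz : 0 < z.re) :
    Summable (fun m : ℕ => ‖exp (-((N * m + a : ℤ) * z))‖) := by
  simp only [geomExp_term, norm_mul, norm_pow]
  exact (summable_geometric_of_lt_one (norm_nonneg _)
    (norm_exp_neg_natCast_mul_lt_one hN hz)).mul_left _

lemma exists_polynomial_isBigO_sub {f : ℂ → ℂ} (hf : AnalyticAt ℂ f 0) (M : ℕ) :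
    ∃ P : Polynomial ℂ, (fun z => f z - P.eval z) =O[𝓝 0] fun z : ℂ => z ^ M := by
  obtain ⟨p, hp⟩ := hf
  refine ⟨∑ k ∈ Finset.range M, Polynomial.monomial k (p.coeff k), ?_⟩
  have h1 := hp.isBigO_sub_partialSum_pow M
  refine IsBigO.congr' (h1.trans (isBigO_of_le _ fun z => by simp)) ?_ EventuallyEq.rfl
  refine Eventually.of_forall fun z => ?_
  simp only [zero_add, FormalMultilinearSeries.partialSum, Polynomial.eval_finsetSum,
    Polynomial.eval_monomial, FormalMultilinearSeries.apply_eq_pow_smul_coeff, smul_eq_mul]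
  congr 1
  exact Finset.sum_congr rfl fun k _ => mul_comm _ _

/-- The simple pole at `0` is removed by the factor `z`: the quotient `(1 - exp (-N z)) / z` extends
analytically with value `N ≠ 0`, so a Taylor polynomial exists. -/
lemma exists_polynomial_geomExp {N : ℕ} (hN : 1 ≤ N) (a : ℤ) (M : ℕ) :
    ∃ P : Polynomial ℂ, (fun z => z * geomExp N a z - P.eval z) =O[𝓝[≠] 0] fun z : ℂ => z ^ M := by
  set f : ℂ → ℂ := fun z => 1 - exp (-(N * z)) with hf
  have hderiv : HasDerivAt f N 0 := by
    have := (((hasDerivAt_id (0 : ℂ)).const_mul (N : ℂ)).fun_neg.cexp).const_sub 1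
    simpa [hf] using this
  have hfa : AnalyticAt ℂ f 0 := by
    have : Differentiable ℂ f := by fun_prop
    exact this.analyticAt 0
  have hd : AnalyticAt ℂ (dslope f 0) 0 := by
    obtain ⟨p, hp⟩ := hfa
    exact ⟨_, hp.has_fpower_series_dslope_fslope⟩
  have hd0 : dslope f 0 0 ≠ 0 := by
    rw [dslope_same, hderiv.deriv]
    exact Nat.cast_ne_zero.2 (by omega)
  have he : AnalyticAt ℂ (fun z : ℂ => exp (-(a * z))) 0 := by
    have : Differentiable ℂ fun z : ℂ => exp (-(a * z)) := by fun_prop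
    exact this.analyticAt 0
  obtain ⟨P, hP⟩ := exists_polynomial_isBigO_sub (he.div hd hd0) M
  refine ⟨P, (hP.mono nhdsWithin_le_nhds).congr' ?_ EventuallyEq.rfl⟩
  filter_upwards [self_mem_nhdsWithin] with z hz
  have hz : z ≠ 0 := hz
  have : dslope f 0 z = f z / z := by
    rw [dslope_of_ne _ hz, slope_def_field, sub_zero]; simp [hf]
  rw [Pi.div_apply, this, geomExp, div_div_eq_mul_div, mul_comm z, div_mul_eq_mul_div]

/-! ### The linear functional attached to Gamma quotients -/

/-- The linear functional on polynomials with `X ^ j ↦ x (x + 1) ⋯ (x + j - 1)`. -/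
noncomputable def risingFunctional (x : ℂ) : Polynomial ℂ →ₗ[ℂ] ℂ :=
  Polynomial.lsum fun j => LinearMap.id.smulRight ((ascPochhammer ℂ j).eval x)

lemma risingFunctional_apply (x : ℂ) (S : Polynomial ℂ) :
    risingFunctional x S = ∑ j ∈ S.support, S.coeff j * (ascPochhammer ℂ j).eval x := by
  simp [risingFunctional, Polynomial.lsum_apply, Polynomial.sum_def]

lemma risingFunctional_monomial (x : ℂ) (j : ℕ) (c : ℂ) :
    risingFunctional x (Polynomial.monomial j c) = c * (ascPochhammer ℂ j).eval x := by
  simp [risingFunctional, Polynomial.lsum_apply, Polynomial.sum_monomial_index]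

lemma differentiable_risingFunctional (S : Polynomial ℂ) :
    Differentiable ℂ fun x => risingFunctional x S := by
  simp only [risingFunctional_apply]
  exact Differentiable.fun_sum fun j _ => (Polynomial.differentiable _).const_mul _

/-- Replacing `X` by `t X` in a monomial `c X ^ n` pulls out `t ^ n`. With `t = τ` this is the
source of the rationality of the period functions. -/
lemma exists_polynomial_risingFunctional (x : ℂ) (P Q : Polynomial ℂ) :
    ∃ R : Polynomial ℂ, ∀ t : ℂ,
      risingFunctional x (P.comp (Polynomial.C t * Polynomial.X) * Q) = R.eval t := by
  induction P using Polynomial.induction_on' with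
  | add p q hp hq =>
    obtain ⟨R, hR⟩ := hp
    obtain ⟨R', hR'⟩ := hq
    exact ⟨R + R', fun t => by
      rw [Polynomial.add_comp, add_mul, map_add, hR, hR', Polynomial.eval_add]⟩
  | monomial n c =>
    refine ⟨Polynomial.monomial n (c * risingFunctional x (Polynomial.X ^ n * Q)), fun t => ?_⟩
    rw [Polynomial.monomial_comp, mul_pow, ← Polynomial.C_pow, mul_assoc, mul_assoc,
      ← Polynomial.smul_eq_C_mul, ← Polynomial.smul_eq_C_mul, map_smul, map_smul,
      Polynomial.eval_monomial, smul_eq_mul, smul_eq_mul]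
    ring

lemma Gamma_add_nat {x : ℂ} (hx : 0 < x.re) (j : ℕ) :
    Gamma (x + j) = (ascPochhammer ℂ j).eval x * Gamma x := by
  induction j with
  | zero => simp
  | succ j ih =>
    have hne : x + j ≠ 0 := fun h => by
      have := congrArg Complex.re h
      simp at this
      linarith [(Nat.cast_nonneg j : (0 : ℝ) ≤ j)]
    rw [Nat.cast_succ, ← add_assoc, Gamma_add_one _ hne, ih, ascPochhammer_succ_eval]
    ring

/-- The monomial `X ^ n` contributes `ρ ^ (-s) Γ(s - 2 + n)`, which is `Γ(s - 2)` times a rising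
factorial. Collecting these gives `risingFunctional`. -/
lemma hasMellin_exp_mul_polynomial {ρ s : ℂ} (hρ : 0 < ρ.re) (hs : 2 < s.re)
    (S : Polynomial ℂ) :
    HasMellin (fun t : ℝ => exp (-(ρ * t)) * (S.eval (ρ * t) / (ρ * t) ^ 2)) s
      (ρ ^ (-s) * Gamma (s - 2) * risingFunctional (s - 2) S) := by
  have hρ0 : ρ ≠ 0 := by rintro rfl; simp at hρ
  induction S using Polynomial.induction_on' with
  | add p q hp hq =>
    have := hasMellin_add hp.1 hq.1
    rw [hp.2, hq.2] at this
    convert this using 1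
    · ext t; rw [Polynomial.eval_add]; ring
    · rw [map_add]; ring
  | monomial n c =>
    have hre : 0 < (s - 2 + n).re := by
      simp
      linarith [(Nat.cast_nonneg n : (0 : ℝ) ≤ n)]
    have hint := integrableOn_cpow_mul_exp hre hρ
    have hval := integral_cpow_mul_exp hre hρ
    have hEq : ∀ t ∈ Ioi (0 : ℝ), (t : ℂ) ^ (s - 1) •
        (exp (-(ρ * t)) * ((Polynomial.monomial n c).eval (ρ * t) / (ρ * t) ^ 2)) =
        c * ρ ^ ((n : ℂ) - 2) * ((t : ℂ) ^ (s - 2 + n - 1) * exp (-(ρ * t))) := by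
      intro t ht
      have ht : 0 < t := ht
      have ht0 : (t : ℂ) ≠ 0 := ofReal_ne_zero.2 ht.ne'
      have h1 : (t : ℂ) ^ (s - 2 + n - 1) = t ^ (s - 1) * t ^ n / t ^ 2 := by
        rw [← cpow_natCast _ n, ← cpow_add _ _ ht0, ← cpow_ofNat, ← cpow_sub _ _ ht0]
        congr 1; ring
      have h2 : ρ ^ ((n : ℂ) - 2) = ρ ^ n / ρ ^ 2 := by
        rw [cpow_sub _ _ hρ0, cpow_natCast, cpow_ofNat]
      rw [h1, h2, Polynomial.eval_monomial, smul_eq_mul, mul_pow]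
      field_simp
    refine ⟨(IntegrableOn.congr_fun (hint.const_mul (c * ρ ^ ((n : ℂ) - 2)))
      (fun t ht => (hEq t ht).symm) measurableSet_Ioi), ?_⟩
    rw [mellin, setIntegral_congr_fun measurableSet_Ioi hEq, integral_const_mul, hval,
      risingFunctional_monomial, Gamma_add_nat (by simpa using hs)]
    have : ρ ^ ((n : ℂ) - 2) * ρ ^ (-(s - 2 + n)) = ρ ^ (-s) := by
      rw [← cpow_add _ _ hρ0]; congr 1; ring
    rw [← this]; ring

/-! ### Gluing continuations to half planes -/

lemma exists_entire_of_halfPlanes {F : ℕ → ℂ → ℂ}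
    (hd : ∀ M : ℕ, DifferentiableOn ℂ (F M) {s | 2 - (M : ℝ) < s.re})
    (heq : ∀ (M : ℕ) (s : ℂ), 2 < s.re → F M s = F 0 s) :
    ∃ H : ℂ → ℂ, Differentiable ℂ H ∧ ∀ (M : ℕ) (s : ℂ), 2 - (M : ℝ) < s.re → H s = F M s := by
  have hopen : ∀ M : ℕ, IsOpen {s : ℂ | 2 - (M : ℝ) < s.re} := fun M =>
    isOpen_lt continuous_const Complex.continuous_re
  have hmono : ∀ M M' : ℕ, M ≤ M' → ∀ s : ℂ, 2 - (M : ℝ) < s.re → F M s = F M' s := by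
    intro M M' hM s hs
    have hsub : {s : ℂ | 2 - (M : ℝ) < s.re} ⊆ {s | 2 - (M' : ℝ) < s.re} := fun z hz => by
      have : (M : ℝ) ≤ M' := by exact_mod_cast hM
      have hz : 2 - (M : ℝ) < z.re := hz
      show 2 - (M' : ℝ) < z.re
      linarith
    have hM0 : (0 : ℝ) ≤ M := Nat.cast_nonneg M
    refine ((hd M).analyticOnNhd (hopen M)).eqOn_of_preconnected_of_eventuallyEq
      (((hd M').mono hsub).analyticOnNhd (hopen M)) (convex_halfSpace_re_gt _).isPreconnected
      (z₀ := 3) (show 2 - (M : ℝ) < (3 : ℂ).re by simp; linarith) ?_ hs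
    filter_upwards [(isOpen_lt continuous_const Complex.continuous_re).mem_nhds
      (show (2 : ℝ) < (3 : ℂ).re by norm_num)] with z hz
    rw [heq M z hz, heq M' z hz]
  -- At `s` the function with index `⌈2 - Re s⌉₊ + 1` is used: its half plane contains `s`, and by
  -- `hmono` any other admissible index gives the same value.
  have hindex : ∀ s : ℂ, 2 - ((⌈2 - s.re⌉₊ + 1 : ℕ) : ℝ) < s.re := fun s => by
    have := Nat.le_ceil (2 - s.re)
    push_cast; linarith
  have hH : ∀ (M : ℕ) (s : ℂ), 2 - (M : ℝ) < s.re → F (⌈2 - s.re⌉₊ + 1) s = F M s := by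
    intro M s hs
    rcases le_total M (⌈2 - s.re⌉₊ + 1) with h | h
    · exact (hmono _ _ h s hs).symm
    · exact hmono _ _ h s (hindex s)
  refine ⟨fun s => F (⌈2 - s.re⌉₊ + 1) s, fun s => ?_, hH⟩
  have hmem := (hopen _).mem_nhds (hindex s)
  refine ((hd _).differentiableAt hmem).congr_of_eventuallyEq ?_
  filter_upwards [hmem] with z hz
  exact hH _ z hz

/-! ### The sum over a wedge of lattice points -/

/-- The point `(N m + a) τ + (N n + 1)`. -/
noncomputable def wedgePt (N : ℕ) (a : ℤ) (τ : ℂ) (p : ℕ × ℕ) : ℂ :=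
  ((N * p.1 + a : ℤ) : ℂ) * τ + ((N * p.2 + 1 : ℤ) : ℂ)

/-- A direction in which the wedge spanned by `1` and `τ` turns into the right half plane. -/
noncomputable def wedgeDir (τ : ℂ) : ℂ := ‖τ‖ + (starRingEnd ℂ) τ

/-- The direction is conjugate to `|τ| + τ`, the bisector of `1` and `τ`. Multiplication by it
therefore puts `1` and `τ` at the angles `∓ arg τ / 2`, both in the right half plane. -/
lemma wedgeDir_re_pos (τ : ℍ) : 0 < (wedgeDir τ).re := by
  have h1 : |(τ : ℂ).re| < ‖(τ : ℂ)‖ := abs_re_lt_norm.2 τ.im_pos.ne'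
  have := (abs_lt.1 h1).1
  simp [wedgeDir] at *; linarith

lemma wedgeDir_mul_re_pos (τ : ℍ) : 0 < (wedgeDir τ * τ).re := by
  have h1 : |(τ : ℂ).re| < ‖(τ : ℂ)‖ := abs_re_lt_norm.2 τ.im_pos.ne'
  have h2 := (abs_lt.1 h1).1
  have h3 : wedgeDir τ * τ = ((‖(τ : ℂ)‖ : ℝ) : ℂ) * ((‖(τ : ℂ)‖ : ℝ) + τ) := by
    rw [wedgeDir, add_mul, ← normSq_eq_conj_mul_self, normSq_eq_norm_sq]
    push_cast; ring
  rw [h3, re_ofReal_mul, add_re, ofReal_re]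
  exact mul_pos (norm_pos_iff.2 τ.ne_zero) (by linarith)

lemma wedgeDir_im_neg (τ : ℍ) : (wedgeDir τ).im < 0 := by
  have := τ.im_pos
  simp [wedgeDir, this]

lemma wedgePair_mem_posPairs (N : ℕ) {a : ℤ} (ha : 0 ≤ a) (p : ℕ × ℕ) :
    ((N * p.1 + a : ℤ), (N * p.2 + 1 : ℤ)) ∈ posPairs := by
  have h1 : (0 : ℤ) ≤ N * p.1 := by positivity
  have h2 : (0 : ℤ) ≤ N * p.2 := by positivity
  simp only [posPairs, mem_ofPred_eq]
  omega

/-- The direction has argument in `(-π, 0)` and `w` in `[0, π)`, so the sum of the arguments stays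
in `(-π, π)`. -/
lemma wedgeDir_mul_cpow (τ : ℍ) {w : ℂ} (hw : w ≠ 0) (h0 : 0 ≤ w.arg) (h1 : w.arg < Real.pi)
    (s : ℂ) : (wedgeDir τ * w) ^ s = wedgeDir τ ^ s * w ^ s := by
  have hne : wedgeDir τ ≠ 0 := fun h => by
    have := wedgeDir_re_pos τ; rw [h] at this; simp at this
  have h2 : (wedgeDir τ).arg < 0 := arg_neg_iff.2 (wedgeDir_im_neg τ)
  have h3 := neg_pi_lt_arg (wedgeDir τ)
  rw [cpow_def_of_ne_zero (mul_ne_zero hne hw), log_mul hne hw ⟨by linarith, by linarith⟩,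
    cpow_def_of_ne_zero hne, cpow_def_of_ne_zero hw, ← exp_add]
  ring_nf

/-- The generating function of the wedge along the direction `ρ`. -/
noncomputable def wedgeGen (N : ℕ) (a : ℤ) (τ ρ : ℂ) (t : ℝ) : ℂ :=
  exp (-(ρ * t)) * (geomExp N a (ρ * τ * t) * geomExp N 0 (ρ * t))

lemma hasSum_mul_of_summable_norm {f g : ℕ → ℂ} {x y : ℂ} (hf : HasSum f x) (hg : HasSum g y)
    (hf' : Summable fun n => ‖f n‖) (hg' : Summable fun n => ‖g n‖) :
    HasSum (fun p : ℕ × ℕ => f p.1 * g p.2) (x * y) :=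
  hf.mul hg (summable_mul_of_summable_norm hf' hg')

lemma hasSum_wedgeGen {N : ℕ} (hN : 1 ≤ N) (a : ℤ) {τ ρ : ℂ} (hρ : 0 < ρ.re)
    (hρτ : 0 < (ρ * τ).re) {t : ℝ} (ht : 0 < t) :
    HasSum (fun p => exp (-(ρ * wedgePt N a τ p * t))) (wedgeGen N a τ ρ t) := by
  have h1 : 0 < (ρ * τ * t).re := by rw [re_mul_ofReal]; positivity
  have h2 : 0 < (ρ * t).re := by rw [re_mul_ofReal]; positivity
  have hmul := (hasSum_mul_of_summable_norm (hasSum_geomExp hN a h1) (hasSum_geomExp hN 0 h2)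
    (summable_norm_geomExp hN a h1) (summable_norm_geomExp hN 0 h2)).mul_left (exp (-(ρ * t)))
  have hterm : ∀ p : ℕ × ℕ, exp (-(ρ * wedgePt N a τ p * t)) = exp (-(ρ * t)) *
      (exp (-((N * p.1 + a : ℤ) * (ρ * τ * t))) * exp (-((N * p.2 + 0 : ℤ) * (ρ * t)))) := by
    intro p
    rw [← exp_add, ← exp_add, wedgePt]
    congr 1
    push_cast
    ring
  simp only [hterm]
  exact hmul

/-- Both coordinates are nonnegative, so the real part is a positive combination and dominates its
larger summand. This linear growth gives convergence by comparison with the full lattice. -/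
lemma le_re_mul_wedgePt {N : ℕ} {a : ℤ} (ha : 0 ≤ a) {τ ρ : ℂ} (hρ : 0 < ρ.re)
    (hρτ : 0 < (ρ * τ).re) (p : ℕ × ℕ) :
    min ρ.re (ρ * τ).re * ‖![(N * p.1 + a : ℤ), (N * p.2 + 1 : ℤ)]‖ ≤
      (ρ * wedgePt N a τ p).re := by
  have h1 : (0 : ℤ) ≤ N * p.1 + a := by positivity
  have h2 : (0 : ℤ) ≤ N * p.2 + 1 := by positivity
  have hre : (ρ * wedgePt N a τ p).re
      = ((N * p.1 + a : ℤ) : ℝ) * (ρ * τ).re + ((N * p.2 + 1 : ℤ) : ℝ) * ρ.re := by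
    have : ρ * wedgePt N a τ p = (((N * p.1 + a : ℤ) : ℝ) : ℂ) * (ρ * τ) +
        (((N * p.2 + 1 : ℤ) : ℝ) : ℂ) * ρ := by
      rw [wedgePt]; push_cast; ring
    rw [this, add_re, re_ofReal_mul, re_ofReal_mul]
  have h1' : (0 : ℝ) ≤ ((N * p.1 + a : ℤ) : ℝ) := by exact_mod_cast h1
  have h2' : (0 : ℝ) ≤ ((N * p.2 + 1 : ℤ) : ℝ) := by exact_mod_cast h2
  rw [EisensteinSeries.norm_eq_max_natAbs, hre]
  simp only [Matrix.cons_val_zero, Matrix.cons_val_one, Nat.cast_max, Nat.cast_natAbs,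
    abs_of_nonneg h1, abs_of_nonneg h2]
  have hmin : 0 < min ρ.re (ρ * τ).re := lt_min hρ hρτ
  rcases max_cases (((N * p.1 + a : ℤ) : ℝ)) ((N * p.2 + 1 : ℤ) : ℝ) with ⟨h, -⟩ | ⟨h, -⟩ <;>
    rw [h]
  · have := mul_le_mul_of_nonneg_left (min_le_right ρ.re (ρ * τ).re) h1'
    have := mul_nonneg h2' hρ.le
    linarith
  · have := mul_le_mul_of_nonneg_left (min_le_left ρ.re (ρ * τ).re) h2'
    have := mul_nonneg h1' hρτ.le
    linarith

/-- Termwise integration of the generating function; the `L¹` norms of the terms are summable by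
`le_re_mul_wedgePt`. -/
lemma hasSum_mellin_wedgeGen {N : ℕ} (hN : 1 ≤ N) {a : ℤ} (ha : 0 ≤ a) {τ ρ s : ℂ}
    (hρ : 0 < ρ.re) (hρτ : 0 < (ρ * τ).re) (hs : 2 < s.re) :
    HasSum (fun p => (ρ * wedgePt N a τ p) ^ (-s) * Gamma s) (mellin (wedgeGen N a τ ρ) s) := by
  have hmin : 0 < min ρ.re (ρ * τ).re := lt_min hρ hρτ
  have hs0 : 0 < s.re := by linarith
  have hnorm : ∀ p : ℕ × ℕ, 0 < ‖![(N * p.1 + a : ℤ), (N * p.2 + 1 : ℤ)]‖ := by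
    intro p
    rw [norm_pos_iff]
    intro h
    have := congrFun h 1
    have h2 : (0 : ℤ) ≤ N * p.2 := by positivity
    simp at this
    omega
  have hpos : ∀ p, 0 < (ρ * wedgePt N a τ p).re := fun p =>
    (mul_pos hmin (hnorm p)).trans_le (le_re_mul_wedgePt ha hρ hρτ p)
  have hN0 : (N : ℤ) ≠ 0 := by omega
  have hinj : Function.Injective
      (fun p : ℕ × ℕ => ((N * p.1 + a : ℤ), (N * p.2 + 1 : ℤ))) := by
    rintro ⟨m, n⟩ ⟨m', n'⟩ h'
    simpa [hN0, show N ≠ 0 by omega] using h'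
  have hsum : Summable fun p => (ρ * wedgePt N a τ p).re ^ (-s.re) * Real.Gamma s.re := by
    refine Summable.mul_right _ (Summable.of_nonneg_of_le
      (fun p => Real.rpow_nonneg (hpos p).le _) (fun p => ?_)
      (((summable_norm_int_pair hs).comp_injective hinj).mul_left
        ((min ρ.re (ρ * τ).re) ^ (-s.re))))
    rw [Function.comp, ← Real.mul_rpow hmin.le (norm_nonneg _)]
    exact Real.rpow_le_rpow_of_nonpos (mul_pos hmin (hnorm p)) (le_re_mul_wedgePt ha hρ hρτ p)
      (by linarith)
  have key := hasSum_integral_of_summable_integral_norm (μ := volume.restrict (Ioi (0 : ℝ)))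
    (F := fun p (t : ℝ) => (t : ℂ) ^ (s - 1) * exp (-(ρ * wedgePt N a τ p * t)))
    (fun p => integrableOn_cpow_mul_exp hs0 (hpos p))
    (by simpa only [integral_norm_cpow_mul_exp hs0 (hpos _)] using hsum)
  have hmellin : mellin (wedgeGen N a τ ρ) s = ∫ t in Ioi (0 : ℝ),
      ∑' p, (t : ℂ) ^ (s - 1) * exp (-(ρ * wedgePt N a τ p * t)) := by
    refine setIntegral_congr_fun measurableSet_Ioi fun t ht => ?_
    rw [tsum_mul_left, (hasSum_wedgeGen hN a hρ hρτ ht).tsum_eq, smul_eq_mul]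
  rw [hmellin]
  exact key.congr_fun fun p => (integral_cpow_mul_exp hs0 (hpos p)).symm

/-! ### Asymptotics of the generating function at infinity and at zero -/

lemma isBigO_polynomial_exp (S : Polynomial ℂ) (c : ℂ) {ε : ℝ} (hε : 0 < ε) :
    (fun t : ℝ => S.eval (c * t)) =O[atTop] fun t : ℝ => Real.exp (ε * t) := by
  induction S using Polynomial.induction_on' with
  | add p q hp hq => simpa only [Polynomial.eval_add] using hp.add hq
  | monomial n a =>
    have h1 : (fun t : ℝ => (Polynomial.monomial n a).eval (c * t)) =O[atTop] fun t : ℝ => t ^ n := by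
      refine IsBigO.of_bound (‖a‖ * ‖c‖ ^ n) (Eventually.of_forall fun t => ?_)
      rw [Polynomial.eval_monomial, norm_mul, norm_pow, norm_mul, norm_real, norm_pow, mul_pow]
      exact le_of_eq (by ring)
    exact h1.trans (isLittleO_pow_exp_pos_mul_atTop n hε).isBigO

lemma isBigO_exp_neg_mul (c : ℂ) :
    (fun t : ℝ => exp (-(c * t))) =O[atTop] fun t : ℝ => Real.exp (-c.re * t) := by
  refine isBigO_of_le _ fun t => ?_
  rw [norm_exp, Real.norm_of_nonneg (Real.exp_pos _).le]
  simp

lemma isBigO_geomExp_atTop {N : ℕ} (hN : 1 ≤ N) {a : ℤ} (ha : 0 ≤ a) {c : ℂ} (hc : 0 < c.re) :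
    (fun t : ℝ => geomExp N a (c * t)) =O[atTop] fun _ => (1 : ℝ) := by
  have hN0 : (0 : ℝ) < N := by exact_mod_cast hN
  have h1 : (fun t : ℝ => exp (-(a * (c * t)))) =O[atTop] fun _ => (1 : ℝ) := by
    refine IsBigO.of_bound 1 ?_
    filter_upwards [eventually_ge_atTop 0] with t ht
    have ha' : (0 : ℝ) ≤ a := by exact_mod_cast ha
    have : (-(a * (c * t)) : ℂ).re = -(a * (c.re * t)) := by simp
    rw [norm_exp, this, norm_one, mul_one, Real.exp_le_one_iff, neg_nonpos]
    positivity
  have h2 : Tendsto (fun t : ℝ => (1 - exp (-(N * (c * t))))⁻¹) atTop (𝓝 (1 - 0)⁻¹) := by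
    refine (tendsto_const_nhds.sub ?_).inv₀ (by simp)
    rw [tendsto_zero_iff_norm_tendsto_zero]
    have h3 : Tendsto (fun t : ℝ => Real.exp (-(N * c.re * t))) atTop (𝓝 0) :=
      Real.tendsto_exp_neg_atTop_nhds_zero.comp (tendsto_id.const_mul_atTop (by positivity))
    refine h3.congr fun t => ?_
    have : (-(N * (c * t)) : ℂ).re = -(N * c.re * t) := by simp; ring
    rw [norm_exp, this]
  have h3 : (fun t : ℝ => (1 - exp (-(N * (c * t))))⁻¹) =O[atTop] fun _ => (1 : ℝ) :=
    h2.isBigO_one ℝ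
  simpa [geomExp, div_eq_mul_inv] using h1.mul h3

/-- The generating function of the wedge with a polynomial multiple of the principal part taken
away. -/
noncomputable def wedgeDiff (N : ℕ) (a : ℤ) (τ ρ : ℂ) (S : Polynomial ℂ) (t : ℝ) : ℂ :=
  wedgeGen N a τ ρ t - τ⁻¹ * (exp (-(ρ * t)) * (S.eval (ρ * t) / (ρ * t) ^ 2))

lemma isBigO_wedgeDiff_atTop {N : ℕ} (hN : 1 ≤ N) {a : ℤ} (ha : 0 ≤ a) {τ ρ : ℂ} (hρ : 0 < ρ.re)
    (hρτ : 0 < (ρ * τ).re) (S : Polynomial ℂ) :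
    wedgeDiff N a τ ρ S =O[atTop] fun t => Real.exp (-(ρ.re / 2) * t) := by
  have hρ0 : ρ ≠ 0 := by rintro rfl; simp at hρ
  have h1 : wedgeGen N a τ ρ =O[atTop] fun t => Real.exp (-(ρ.re / 2) * t) := by
    have := (isBigO_exp_neg_mul ρ).mul
      ((isBigO_geomExp_atTop hN ha hρτ).mul (isBigO_geomExp_atTop hN le_rfl hρ))
    refine this.trans (IsBigO.of_bound 1 ?_)
    filter_upwards [eventually_ge_atTop 0] with t ht
    rw [mul_one, mul_one, one_mul, Real.norm_of_nonneg (Real.exp_pos _).le,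
      Real.norm_of_nonneg (Real.exp_pos _).le]
    apply Real.exp_le_exp.2
    nlinarith
  have h2 : (fun t : ℝ => ((ρ * t) ^ 2)⁻¹) =O[atTop] fun _ => (1 : ℝ) := by
    refine IsBigO.of_bound (‖ρ ^ 2‖⁻¹) ?_
    filter_upwards [eventually_ge_atTop 1] with t ht
    rw [norm_one, mul_one, mul_pow, norm_inv, norm_mul, mul_inv]
    refine mul_le_of_le_one_right (by positivity) (inv_le_one_of_one_le₀ ?_)
    rw [norm_pow, norm_real, Real.norm_of_nonneg (by linarith)]
    exact one_le_pow₀ ht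
  -- Half of the decay rate of `exp (-ρ t)` absorbs the polynomial growth, leaving `Re ρ / 2`.
  have h3 := ((isBigO_exp_neg_mul ρ).mul
    ((isBigO_polynomial_exp S ρ (half_pos hρ)).mul h2)).const_mul_left τ⁻¹
  refine h1.sub (h3.congr_right fun t => ?_)
  rw [mul_one, ← Real.exp_add]
  ring_nf

/-- With both geometric sums replaced by Taylor polynomials up to `O(t ^ M)`, the error of the
product is again `O(t ^ M)`; the two simple poles divide it by `t ^ 2`. -/
lemma isBigO_wedgeDiff_zero {N : ℕ} {a : ℤ} {τ ρ : ℂ} (hτ : τ ≠ 0) (hρ : ρ ≠ 0) {M : ℕ}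
    {P Q : Polynomial ℂ}
    (hP : (fun z => z * geomExp N a z - P.eval z) =O[𝓝[≠] 0] fun z : ℂ => z ^ M)
    (hQ : (fun z => z * geomExp N 0 z - Q.eval z) =O[𝓝[≠] 0] fun z : ℂ => z ^ M) :
    wedgeDiff N a τ ρ (P.comp (Polynomial.C τ * Polynomial.X) * Q)
      =O[𝓝[>] 0] fun t : ℝ => t ^ (-(2 - (M : ℝ))) := by
  have htend : ∀ c : ℂ, c ≠ 0 → Tendsto (fun t : ℝ => c * t) (𝓝[>] 0) (𝓝[≠] 0) := by
    intro c hc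
    refine tendsto_nhdsWithin_iff.2 ⟨?_, ?_⟩
    · have : Continuous fun t : ℝ => c * (t : ℂ) := by fun_prop
      exact (this.tendsto' 0 0 (by simp)).mono_left nhdsWithin_le_nhds
    · filter_upwards [self_mem_nhdsWithin] with t ht
      exact mul_ne_zero hc (ofReal_ne_zero.2 (ne_of_gt ht))
  have hpow : ∀ c : ℂ, (fun t : ℝ => (c * t) ^ M) =O[𝓝[>] 0] fun t : ℝ => t ^ M := by
    intro c
    refine IsBigO.of_bound (‖c‖ ^ M) (Eventually.of_forall fun t => ?_)
    rw [mul_pow, norm_mul, norm_pow, norm_pow, norm_pow, norm_real]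
  have hP' := (hP.comp_tendsto (htend _ (mul_ne_zero hρ hτ))).trans (hpow _)
  have hQ' := (hQ.comp_tendsto (htend _ hρ)).trans (hpow _)
  have hone : ∀ c : ℂ, ∀ S : Polynomial ℂ, (fun t : ℝ => S.eval (c * t)) =O[𝓝[>] 0]
      fun _ => (1 : ℝ) := by
    intro c S
    have : Continuous fun t : ℝ => S.eval (c * (t : ℂ)) :=
      S.continuous.comp (by fun_prop)
    exact ((this.tendsto 0).mono_left nhdsWithin_le_nhds).isBigO_one ℝ
  have hM : (fun t : ℝ => t ^ M) =O[𝓝[>] 0] fun _ => (1 : ℝ) := by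
    have : Continuous fun t : ℝ => t ^ M := by fun_prop
    exact ((this.tendsto 0).mono_left nhdsWithin_le_nhds).isBigO_one ℝ
  have hexp : (fun t : ℝ => exp (-(ρ * t))) =O[𝓝[>] 0] fun _ => (1 : ℝ) := by
    have : Continuous fun t : ℝ => exp (-(ρ * t)) := by fun_prop
    exact ((this.tendsto 0).mono_left nhdsWithin_le_nhds).isBigO_one ℝ
  -- Expansion `f g - P Q = (f - P) (g - Q) + (f - P) Q + P (g - Q)`.
  have hmain := (hP'.mul (hQ'.trans hM)).add
    ((hP'.mul (hone ρ Q)).add (((hone (ρ * τ) P).mul hQ').congr_right fun t => by ring))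
  have hinv : (fun t : ℝ => (τ * (ρ * t) ^ 2)⁻¹) =O[𝓝[>] 0] fun t : ℝ => (t ^ 2)⁻¹ := by
    refine IsBigO.of_bound ‖(τ * ρ ^ 2)⁻¹‖ (Eventually.of_forall fun t => ?_)
    rw [← norm_real (_ : ℝ), ← norm_mul]
    apply le_of_eq
    push_cast
    ring_nf
  refine ((hexp.mul (hinv.mul hmain)).congr' ?_ ?_)
  · filter_upwards [self_mem_nhdsWithin] with t ht
    have ht0 : (t : ℂ) ≠ 0 := ofReal_ne_zero.2 (ne_of_gt ht)
    simp only [Function.comp, wedgeDiff, wedgeGen, Polynomial.eval_mul, Polynomial.eval_comp,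
      Polynomial.eval_C, Polynomial.eval_X]
    have h1 : τ * (ρ * t) = ρ * τ * t := by ring
    rw [h1]
    field_simp
    ring
  · filter_upwards [self_mem_nhdsWithin] with t ht
    have ht : 0 < t := ht
    rw [neg_sub, Real.rpow_sub ht, Real.rpow_natCast, Real.rpow_ofNat]
    field_simp

lemma continuousOn_wedgeDiff {N : ℕ} (hN : 1 ≤ N) (a : ℤ) {τ ρ : ℂ} (hρ : 0 < ρ.re)
    (hρτ : 0 < (ρ * τ).re) (S : Polynomial ℂ) :
    ContinuousOn (wedgeDiff N a τ ρ S) (Ioi 0) := by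
  have hρ0 : ρ ≠ 0 := by rintro rfl; simp at hρ
  have hgeom : ∀ (b : ℤ) (c : ℂ), 0 < c.re →
      ContinuousOn (fun t : ℝ => geomExp N b (c * t)) (Ioi 0) := by
    intro b c hc
    refine ContinuousOn.div (by fun_prop) (by fun_prop) fun t ht => one_sub_exp_ne_zero hN ?_
    have ht : 0 < t := ht
    rw [re_mul_ofReal]; positivity
  have hpoly : Continuous fun t : ℝ => S.eval (ρ * (t : ℂ)) := S.continuous.comp (by fun_prop)
  refine ContinuousOn.sub ?_ (continuousOn_const.mul (ContinuousOn.mul (by fun_prop) ?_))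
  · exact ContinuousOn.mul (by fun_prop) ((hgeom a _ hρτ).mul (hgeom 0 _ hρ))
  · refine hpoly.continuousOn.div (by fun_prop) fun t ht => ?_
    exact pow_ne_zero 2 (mul_ne_zero hρ0 (ofReal_ne_zero.2 (ne_of_gt ht)))

/-! ### Continuation of the wedge sum -/

lemma mellin_wedgeGen {N : ℕ} (hN : 1 ≤ N) {a : ℤ} (ha : 0 ≤ a) {τ ρ s : ℂ} (hτ : τ ≠ 0)
    (hρ : 0 < ρ.re) (hρτ : 0 < (ρ * τ).re) (hs : 2 < s.re) {P Q : Polynomial ℂ} {M : ℕ}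
    (hP : (fun z => z * geomExp N a z - P.eval z) =O[𝓝[≠] 0] fun z : ℂ => z ^ M)
    (hQ : (fun z => z * geomExp N 0 z - Q.eval z) =O[𝓝[≠] 0] fun z : ℂ => z ^ M) :
    mellin (wedgeGen N a τ ρ) s =
      mellin (wedgeDiff N a τ ρ (P.comp (Polynomial.C τ * Polynomial.X) * Q)) s +
        τ⁻¹ * (ρ ^ (-s) * Gamma (s - 2) *
          risingFunctional (s - 2) (P.comp (Polynomial.C τ * Polynomial.X) * Q)) := by
  have hρ0 : ρ ≠ 0 := by rintro rfl; simp at hρ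
  set S := P.comp (Polynomial.C τ * Polynomial.X) * Q
  have h1 : MellinConvergent (wedgeDiff N a τ ρ S) s :=
    mellinConvergent_of_isBigO_rpow_exp (half_pos hρ)
      ((continuousOn_wedgeDiff hN a hρ hρτ S).locallyIntegrableOn measurableSet_Ioi)
      (isBigO_wedgeDiff_atTop hN ha hρ hρτ S) (isBigO_wedgeDiff_zero hτ hρ0 hP hQ)
      (by linarith [(Nat.cast_nonneg M : (0 : ℝ) ≤ M)])
  have h2 := hasMellin_exp_mul_polynomial hρ hs S
  have h3 := hasMellin_const_smul h2.1 τ⁻¹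
  have h4 := (hasMellin_add h1 h3.1).2
  rw [h3.2, h2.2, smul_eq_mul] at h4
  rw [← h4]
  congr 1
  ext t
  simp [wedgeDiff]

/-- Subtracting the expansion at zero moves the region of convergence of the Mellin transform to `Re
s > 2 - M`, and the subtracted part is computed exactly. Dividing by `Γ(s) = (s - 1) (s - 2) Γ(s -
2)` shows the only possible poles. At `s = -n` the factor `1 / Γ(s - 2)` removes the remainder
integral, so only the explicit part is left. The polynomials are chosen before `τ`, which makes that
part rational in `τ`. -/
lemma exists_wedge_halfPlane {N : ℕ} (hN : 1 ≤ N) {a : ℤ} (ha : 0 ≤ a) (M : ℕ) :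
    ∃ P Q : Polynomial ℂ, ∀ τ : ℍ, ∃ F : ℂ → ℂ,
      DifferentiableOn ℂ F {s | 2 - (M : ℝ) < s.re} ∧
      (∀ s : ℂ, 2 < s.re →
        HasSum (fun p => wedgePt N a τ p ^ (-s)) (F s / ((s - 1) * (s - 2)))) ∧
      ∀ n : ℕ, F (-n) = risingFunctional (-n - 2)
        (P.comp (Polynomial.C (τ : ℂ) * Polynomial.X) * Q) / τ := by
  obtain ⟨P, hP⟩ := exists_polynomial_geomExp hN a M
  obtain ⟨Q, hQ⟩ := exists_polynomial_geomExp hN 0 M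
  refine ⟨P, Q, fun τ => ?_⟩
  set ρ := wedgeDir τ
  have hρ : 0 < ρ.re := wedgeDir_re_pos τ
  have hρτ : 0 < (ρ * τ).re := wedgeDir_mul_re_pos τ
  have hρ0 : ρ ≠ 0 := by intro h; simp [h] at hρ
  set S := P.comp (Polynomial.C (τ : ℂ) * Polynomial.X) * Q
  refine ⟨fun s => ρ ^ s * (Gamma (s - 2))⁻¹ * mellin (wedgeDiff N a τ ρ S) s +
    (τ : ℂ)⁻¹ * risingFunctional (s - 2) S, fun s hs => ?_, fun s hs => ?_, fun n => ?_⟩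
  · have h1 : DifferentiableAt ℂ (mellin (wedgeDiff N a τ ρ S)) s :=
      mellin_differentiableAt_of_isBigO_rpow_exp (half_pos hρ)
        ((continuousOn_wedgeDiff hN a hρ hρτ S).locallyIntegrableOn measurableSet_Ioi)
        (isBigO_wedgeDiff_atTop hN ha hρ hρτ S) (isBigO_wedgeDiff_zero τ.ne_zero hρ0 hP hQ) hs
    have h2 : DifferentiableAt ℂ (fun s : ℂ => (Gamma (s - 2))⁻¹) s :=
      DifferentiableAt.comp (f := fun s : ℂ => s - 2) s
        (differentiable_one_div_Gamma (s - 2)) (by fun_prop)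
    have h3 : DifferentiableAt ℂ (fun s : ℂ => risingFunctional (s - 2) S) s :=
      DifferentiableAt.comp (f := fun s : ℂ => s - 2) s
        (differentiable_risingFunctional S (s - 2)) (by fun_prop)
    have h4 : DifferentiableAt ℂ (fun s : ℂ => ρ ^ s) s :=
      differentiableAt_id.const_cpow (Or.inl hρ0)
    exact (((h4.mul h2).mul h1).add (h3.const_mul _)).differentiableWithinAt
  · have hm := mellin_wedgeGen hN ha τ.ne_zero hρ hρτ hs hP hQ
    have hsum := (hasSum_mellin_wedgeGen hN ha hρ hρτ hs).mul_left (ρ ^ s * (Gamma s)⁻¹)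
    have hre2 : 0 < (s - 2).re := by simpa using hs
    have hG0 : Gamma (s - 2) ≠ 0 := Gamma_ne_zero_of_re_pos hre2
    have hs2 : s - 2 ≠ 0 := fun h => by simp [h] at hre2
    have hs1 : s - 1 ≠ 0 := fun h => by
      have := congrArg Complex.re h
      simp at this; linarith
    have hG : Gamma s = (s - 1) * (s - 2) * Gamma (s - 2) := by
      have h1 := Gamma_add_one (s - 2) hs2
      have h2 := Gamma_add_one (s - 1) hs1
      rw [sub_add_cancel] at h2
      rw [h2, ← mul_assoc] at *
      rw [show s - 1 = s - 2 + 1 by ring, h1]; ring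
    have hρs : ρ ^ s * ρ ^ (-s) = 1 := by rw [← cpow_add _ _ hρ0]; simp
    have hρs0 : ρ ^ s ≠ 0 := left_ne_zero_of_mul_eq_one hρs
    have hterm : ∀ p, ρ ^ s * (Gamma s)⁻¹ * ((ρ * wedgePt N a τ p) ^ (-s) * Gamma s) =
        wedgePt N a τ p ^ (-s) := by
      intro p
      obtain ⟨g, g0, g1⟩ := latticePt_pos τ (wedgePair_mem_posPairs N ha p)
      have hGs : Gamma s ≠ 0 := Gamma_ne_zero_of_re_pos (by linarith)
      rw [show wedgePt N a τ p = ((N * p.1 + a : ℤ) : ℂ) * τ + ((N * p.2 + 1 : ℤ) : ℂ) from rfl,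
        wedgeDir_mul_cpow τ g g0 g1]
      field_simp
      change ρ ^ s * ρ ^ (-s) * _ = _
      rw [hρs, one_mul]
    simp only [hterm] at hsum
    have hτ := τ.ne_zero
    have hval : ρ ^ s * (Gamma s)⁻¹ * mellin (wedgeGen N a τ ρ) s =
        (ρ ^ s * (Gamma (s - 2))⁻¹ * mellin (wedgeDiff N a τ ρ S) s +
          (τ : ℂ)⁻¹ * risingFunctional (s - 2) S) / ((s - 1) * (s - 2)) := by
      rw [hm, hG]
      field_simp
      linear_combination (Gamma (s - 2) * risingFunctional (s - 2) S) * hρs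
    rwa [hval] at hsum
  · have h0 : Gamma (-n - 2) = 0 := by
      have := Gamma_neg_nat_eq_zero (n + 2)
      rwa [show (-((n + 2 : ℕ) : ℂ)) = -n - 2 by push_cast; ring] at this
    simp only [h0]
    simp [div_eq_inv_mul]

/-- The sum over a wedge of lattice points continues meromorphically, and its values at the
nonpositive integers are rational functions of the period. -/
theorem exists_wedge_continuation {N : ℕ} (hN : 1 ≤ N) {a : ℤ} (ha : 0 ≤ a) :
    ∃ H : ℍ → ℂ → ℂ, (∀ τ, Differentiable ℂ (H τ)) ∧
      (∀ (τ : ℍ) (s : ℂ), 2 < s.re →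
        HasSum (fun p => wedgePt N a τ p ^ (-s)) (H τ s / ((s - 1) * (s - 2)))) ∧
      ∀ n : ℕ, ∃ R : Polynomial ℂ, ∀ τ : ℍ, H τ (-n) = R.eval (τ : ℂ) / τ := by
  choose P Q F hF hsum hval using fun M => exists_wedge_halfPlane hN ha M
  have heq : ∀ (τ : ℍ) (M : ℕ) (s : ℂ), 2 < s.re → F M τ s = F 0 τ s := by
    intro τ M s hs
    have h := (hsum M τ s hs).unique (hsum 0 τ s hs)
    have hs2 : s - 2 ≠ 0 := fun h => by
      have := congrArg Complex.re h
      simp at this; linarith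
    have hs1 : s - 1 ≠ 0 := fun h => by
      have := congrArg Complex.re h
      simp at this; linarith
    field_simp at h
    exact h
  choose H hH hHF using fun τ => exists_entire_of_halfPlanes (fun M => hF M τ) (heq τ)
  refine ⟨H, hH, fun τ s hs => ?_, fun n => ?_⟩
  · rw [hHF τ 0 s (by simpa using hs)]
    exact hsum 0 τ s hs
  -- The order `M = n + 3` puts `-n` inside the half plane `Re s > 2 - M = -n - 1`.
  · obtain ⟨R, hR⟩ := exists_polynomial_risingFunctional (-n - 2) (P (n + 3)) (Q (n + 3))
    refine ⟨R, fun τ => ?_⟩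
    rw [hHF τ (n + 3) (-n) (by push_cast; simp; linarith), hval, hR]

/-! ### The transformation of the Eisenstein series under `τ ↦ -1 / τ` -/

lemma sub_one_ne_zero_of_re {s : ℂ} (hs : 2 < s.re) : s - 1 ≠ 0 := fun h => by
  have := congrArg Complex.re h
  simp at this; linarith

lemma sub_two_ne_zero_of_re {s : ℂ} (hs : 2 < s.re) : s - 2 ≠ 0 := fun h => by
  have := congrArg Complex.re h
  simp at this; linarith

lemma IsLatticeType.nonneg {N : ℕ} {a : ℤ} (h : IsLatticeType N a) : 0 ≤ a := by
  rcases h with h | h <;> omega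

open Classical in
lemma hasSum_wedgePairs {N : ℕ} {a : ℤ} (h : IsLatticeType N a) (τ : ℍ) {s w : ℂ}
    (hw : HasSum (fun p => wedgePt N a τ p ^ (-s)) w) :
    HasSum (fun p => if p ∈ wedgePairs then eisTermMod N a a τ p s else 0) w := by
  have hN0 : (N : ℤ) ≠ 0 := by have := h.pos; omega
  have hinj : Function.Injective
      (fun p : ℕ × ℕ => ((N * p.1 + a : ℤ), (N * p.2 + 1 : ℤ))) := by
    rintro ⟨m, n⟩ ⟨m', n'⟩ h'
    simpa [hN0, show N ≠ 0 by have := h.pos; omega] using h'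
  refine (hinj.hasSum_iff ?_).1 ?_
  · rintro ⟨m, n⟩ hp
    rw [ite_eq_right_iff]
    rintro ⟨hm, hn⟩
    rw [eisTermMod, if_neg]
    rintro ⟨h1, h2⟩
    apply hp
    simp only [Int.ModEq] at h1 h2
    simp only [mem_range, Prod.mk.injEq, Prod.exists] at *
    rcases h with ⟨rfl, rfl⟩ | ⟨rfl, rfl⟩
    · exact ⟨m.toNat, (n - 1).toNat, by push_cast; omega, by push_cast; omega⟩
    · exact ⟨((m - 1) / 2).toNat, ((n - 1) / 2).toNat, by push_cast; omega, by push_cast; omega⟩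
  · have hterm : (fun p => if p ∈ wedgePairs then eisTermMod N a a τ p s else 0) ∘
        (fun p : ℕ × ℕ => ((N * p.1 + a : ℤ), (N * p.2 + 1 : ℤ))) =
        fun p => wedgePt N a τ p ^ (-s) := by
      ext p
      have hmem : ((N * p.1 + a : ℤ), (N * p.2 + 1 : ℤ)) ∈ wedgePairs := by
        have h1 : (0 : ℤ) ≤ N * p.1 := by positivity
        have h2 : (0 : ℤ) ≤ N * p.2 := by positivity
        have := h.nonneg
        simp only [wedgePairs, mem_ofPred_eq]
        omega
      rw [Function.comp, if_pos hmem, eisTermMod, if_pos, eisTerm_of_pos τ (wedgePairs_subset hmem)]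
      · rfl
      · simp only [Int.ModEq]
        rcases h with ⟨rfl, rfl⟩ | ⟨rfl, rfl⟩ <;> push_cast <;> omega
    rw [hterm]
    exact hw

open Classical in
lemma eisTermMod_S_smul {N : ℕ} {a : ℤ} (h : IsLatticeType N a) (τ : ℍ) (p : ℤ × ℤ) (s : ℂ) :
    eisTermMod N a a (ModularGroup.S • τ) p s =
      (τ : ℂ) ^ s * (eisTermMod N a a τ (rotatePair p) s +
        (exp (-(Real.pi * I * s)) - exp (Real.pi * I * s)) *
          if -rotatePair p ∈ wedgePairs then eisTermMod N a a τ (-rotatePair p) s else 0) := by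
  have h1 : ((rotatePair p).1 ≡ a [ZMOD (N : ℤ)] ∧ (rotatePair p).2 ≡ a [ZMOD (N : ℤ)]) ↔
      (p.1 ≡ a [ZMOD (N : ℤ)] ∧ p.2 ≡ a [ZMOD (N : ℤ)]) := by
    simp only [Int.ModEq, rotatePair, Equiv.coe_fn_mk]
    rcases h with ⟨rfl, rfl⟩ | ⟨rfl, rfl⟩ <;> push_cast <;> omega
  have h2 : ((-rotatePair p).1 ≡ a [ZMOD (N : ℤ)] ∧ (-rotatePair p).2 ≡ a [ZMOD (N : ℤ)]) ↔
      (p.1 ≡ a [ZMOD (N : ℤ)] ∧ p.2 ≡ a [ZMOD (N : ℤ)]) := by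
    simp only [Int.ModEq, rotatePair, Equiv.coe_fn_mk, Prod.fst_neg, Prod.snd_neg]
    rcases h with ⟨rfl, rfl⟩ | ⟨rfl, rfl⟩ <;> push_cast <;> omega
  simp only [eisTermMod, h1, h2]
  split_ifs with hc hw hw
  · rw [eisTerm_S_smul, if_pos hw]
  · rw [eisTerm_S_smul, if_neg hw]
  · simp
  · simp

lemma eisEntire_S_smul_of_re {N : ℕ} {a : ℤ} (h : IsLatticeType N a) (τ : ℍ) {s w : ℂ}
    (hs : 2 < s.re) (hw : HasSum (fun p => wedgePt N a τ p ^ (-s)) w) :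
    eisEntire N a (ModularGroup.S • τ : ℍ) s = (τ : ℂ) ^ s * (eisEntire N a τ s +
      (exp (-(Real.pi * I * s)) - exp (Real.pi * I * s)) * w) := by
  classical
  have h1 := (isEntireContinuation_eisEntire h (ModularGroup.S • τ)).2 s hs
  have h2 := rotatePair.hasSum_iff.2 ((isEntireContinuation_eisEntire h τ).2 s hs)
  have h3 := (rotatePair.trans (Equiv.neg (ℤ × ℤ))).hasSum_iff.2 (hasSum_wedgePairs h τ hw)
  have h4 := (h2.add (h3.mul_left (exp (-(Real.pi * I * s)) - exp (Real.pi * I * s)))).mul_left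
    ((τ : ℂ) ^ s)
  refine h1.unique ?_
  have : (fun p => eisTermMod N a a (ModularGroup.S • τ) p s) = _ :=
    funext fun p => eisTermMod_S_smul h τ p s
  rw [this]
  exact h4

/-- Multiplying by `(s - 1) (s - 2)` clears the poles of the wedge sum, so both sides are entire and
the identity extends from `Re s > 2`. -/
lemma eisEntire_S_smul {N : ℕ} {a : ℤ} (h : IsLatticeType N a) (τ : ℍ) {H : ℂ → ℂ}
    (hH : Differentiable ℂ H) (hsum : ∀ s : ℂ, 2 < s.re →
      HasSum (fun p => wedgePt N a τ p ^ (-s)) (H s / ((s - 1) * (s - 2)))) (s : ℂ) :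
    (s - 1) * (s - 2) * eisEntire N a (ModularGroup.S • τ : ℍ) s =
      (τ : ℂ) ^ s * ((s - 1) * (s - 2) * eisEntire N a τ s +
        (exp (-(Real.pi * I * s)) - exp (Real.pi * I * s)) * H s) := by
  have hE := (isEntireContinuation_eisEntire h τ).1
  have hES := (isEntireContinuation_eisEntire h (ModularGroup.S • τ)).1
  have hτ : Differentiable ℂ fun s : ℂ => (τ : ℂ) ^ s := fun s =>
    differentiableAt_id.const_cpow (Or.inl τ.ne_zero)
  have d1 : Differentiable ℂ fun s : ℂ =>
      (s - 1) * (s - 2) * eisEntire N a (ModularGroup.S • τ : ℍ) s := by fun_prop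
  have d2 : Differentiable ℂ fun s : ℂ => (τ : ℂ) ^ s * ((s - 1) * (s - 2) * eisEntire N a τ s +
        (exp (-(Real.pi * I * s)) - exp (Real.pi * I * s)) * H s) := by fun_prop
  refine congrFun ((d1.differentiableOn.analyticOnNhd isOpen_univ).eq_of_eventuallyEq
    (d2.differentiableOn.analyticOnNhd isOpen_univ) (z₀ := 3) ?_) s
  filter_upwards [(isOpen_lt continuous_const Complex.continuous_re).mem_nhds
    (show (2 : ℝ) < (3 : ℂ).re by norm_num)] with z hz
  rw [eisEntire_S_smul_of_re h τ hz (hsum z hz)]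
  have h1 := sub_one_ne_zero_of_re hz
  have h2 := sub_two_ne_zero_of_re hz
  field_simp

/-- The value at `s = -2 k` of the sum over the wedge, in terms of its entire multiple. -/
noncomputable def wedgeValue (H : ℂ → ℂ) (k : ℕ) : ℂ :=
  H (-2 * k) / ((-2 * k - 1) * (-2 * k - 2))

lemma neg_two_mul_sub_ne_zero (k : ℕ) : (-2 * k - 1 : ℂ) ≠ 0 ∧ (-2 * k - 2 : ℂ) ≠ 0 := by
  have hk : (0 : ℝ) ≤ k := Nat.cast_nonneg k
  constructor <;> intro h <;> have := congrArg Complex.re h <;> simp at this <;> linarith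

lemma exp_pi_mul_neg_two_mul (k : ℕ) : exp (Real.pi * I * (-2 * k)) = 1 ∧
    exp (-(Real.pi * I * (-2 * k))) = 1 := by
  constructor
  · rw [exp_eq_one_iff]; exact ⟨-k, by push_cast; ring⟩
  · rw [exp_eq_one_iff]; exact ⟨k, by push_cast; ring⟩

/-- In the derivative at `-2 k` of the transformation formula, every term containing an
undifferentiated Eisenstein series or an undifferentiated difference of exponentials vanishes. The
derivative of that difference is `-2 π i`. -/
theorem eisDeriv_S_smul {N : ℕ} {a : ℤ} (h : IsLatticeType N a) {k : ℕ} (hk : 1 ≤ k) (τ : ℍ)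
    {H : ℂ → ℂ} (hH : Differentiable ℂ H) (hsum : ∀ s : ℂ, 2 < s.re →
      HasSum (fun p => wedgePt N a τ p ^ (-s)) (H s / ((s - 1) * (s - 2)))) :
    eisDeriv N a k (ModularGroup.S • τ : ℍ) = (τ : ℂ) ^ (-2 * k : ℤ) *
      (eisDeriv N a k τ - 2 * Real.pi * I * wedgeValue H k) := by
  obtain ⟨n1, n2⟩ := neg_two_mul_sub_ne_zero k
  obtain ⟨e1, e2⟩ := exp_pi_mul_neg_two_mul k
  set c : ℂ := -2 * k with hc
  have hES : HasDerivAt (eisEntire N a (ModularGroup.S • τ : ℍ))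
      (eisDeriv N a k (ModularGroup.S • τ : ℍ)) c := hasDerivAt_eisEntire h.pos a k _
  have hE : HasDerivAt (eisEntire N a τ) (eisDeriv N a k τ) c := hasDerivAt_eisEntire h.pos a k τ
  have zS : eisEntire N a (ModularGroup.S • τ : ℍ) c = 0 := eisEntire_neg_two_mul hk N a _
  have z : eisEntire N a τ c = 0 := eisEntire_neg_two_mul hk N a _
  have hq : HasDerivAt (fun s : ℂ => (s - 1) * (s - 2)) (1 * (c - 2) + (c - 1) * 1) c :=
    ((hasDerivAt_id c).sub_const 1).mul ((hasDerivAt_id c).sub_const 2)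
  have hD : HasDerivAt (fun s : ℂ => exp (-(Real.pi * I * s)) - exp (Real.pi * I * s))
      (exp (-(Real.pi * I * c)) * (-(Real.pi * I)) - exp (Real.pi * I * c) * (Real.pi * I)) c := by
    have h1 := ((hasDerivAt_id c).const_mul ((Real.pi : ℂ) * I))
    have h2 := h1.fun_neg.cexp.fun_sub h1.cexp
    simpa using h2
  have hτ : HasDerivAt (fun s : ℂ => (τ : ℂ) ^ s) ((τ : ℂ) ^ c * log τ) c := by
    simpa using (hasDerivAt_id c).const_cpow (Or.inl τ.ne_zero)
  have hL := hq.mul hES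
  have hR := hτ.mul ((hq.mul hE).add (hD.mul (hH c).hasDerivAt))
  have hfun : (fun s : ℂ => (s - 1) * (s - 2)) * eisEntire N a (ModularGroup.S • τ : ℍ) =
      (fun s : ℂ => (τ : ℂ) ^ s) * ((fun s : ℂ => (s - 1) * (s - 2)) * eisEntire N a τ +
        (fun s : ℂ => exp (-(Real.pi * I * s)) - exp (Real.pi * I * s)) * H) := by
    ext s
    exact eisEntire_S_smul h τ hH hsum s
  rw [hfun] at hL
  have key := hL.unique hR
  simp only [Pi.add_apply, Pi.mul_apply, zS, z, e1, e2, sub_self, mul_zero, zero_mul, zero_add,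
    add_zero] at key
  have hpow : (τ : ℂ) ^ c = (τ : ℂ) ^ (-2 * k : ℤ) := by
    rw [← cpow_intCast]; push_cast; rw [hc]
  rw [hpow] at key
  rw [wedgeValue, ← hc]
  field_simp
  linear_combination key

/-! ### Barnes' double zeta function -/

/-- The difference has infinite order at `3`, hence everywhere by connectedness. This gives equality
only on punctured neighbourhoods; the normal form fixes the remaining values, poles included. -/
lemma IsMeromorphicContinuation.eq {ι : Type} {u : ι → ℂ → ℂ} {F₁ F₂ : ℂ → ℂ}
    (h₁ : IsMeromorphicContinuation u F₁) (h₂ : IsMeromorphicContinuation u F₂) : F₁ = F₂ := by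
  have hm₁ : MeromorphicOn F₁ univ := h₁.1.meromorphicOn
  have hm₂ : MeromorphicOn F₂ univ := h₂.1.meromorphicOn
  have hm : MeromorphicOn (F₁ - F₂) univ := hm₁.sub hm₂
  have h3 : meromorphicOrderAt (F₁ - F₂) 3 = ⊤ := by
    rw [meromorphicOrderAt_eq_top_iff]
    filter_upwards [nhdsWithin_le_nhds ((isOpen_lt continuous_const Complex.continuous_re).mem_nhds
      (show (2 : ℝ) < (3 : ℂ).re by norm_num))] with s hs
    rw [Pi.sub_apply, (h₁.2 s hs).unique (h₂.2 s hs), sub_self]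
  have hall : ∀ x : ℂ, meromorphicOrderAt (F₁ - F₂) x = ⊤ := by
    intro x
    by_contra hx
    exact (hm.exists_meromorphicOrderAt_ne_top_iff_forall_mem isConnected_univ).1
      ⟨x, mem_univ x, hx⟩ 3 (mem_univ _) h3
  ext x
  have h4 : F₁ =ᶠ[𝓝[≠] x] F₂ := by
    filter_upwards [meromorphicOrderAt_eq_top_iff.1 (hall x)] with z hz
    exact sub_eq_zero.1 hz
  exact (((h₁.1 (mem_univ x)).eventuallyEq_nhdsNE_iff_eventuallyEq_nhds
    (h₂.1 (mem_univ x))).1 h4).eq_of_nhds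

lemma IsMeromorphicContinuation.meromorphicContinuation_eq {ι : Type} {u : ι → ℂ → ℂ}
    {F : ℂ → ℂ} (h : IsMeromorphicContinuation u F) : meromorphicContinuation u = F := by
  have hex : ∃ F, IsMeromorphicContinuation u F := ⟨F, h⟩
  rw [meromorphicContinuation, dif_pos hex]
  exact hex.choose_spec.eq h

lemma toMeromorphicNFOn_eventuallyEq_of_analyticAt {f : ℂ → ℂ} (hf : MeromorphicOn f univ) {s : ℂ}
    (hs : AnalyticAt ℂ f s) : toMeromorphicNFOn f univ =ᶠ[𝓝 s] f := by
  have h := toMeromorphicNFOn_eq_toMeromorphicNFAt_on_nhds hf (mem_univ s)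
  rwa [toMeromorphicNFAt_eq_self.2 hs.meromorphicNFAt] at h

lemma meromorphicAt_riemannZeta (s : ℂ) : MeromorphicAt riemannZeta s := by
  by_cases hs : s = 1
  swap
  · refine (DifferentiableOn.analyticAt (s := {1}ᶜ) (fun z hz => ?_)
      (isOpen_ne.mem_nhds hs)).meromorphicAt
    exact (differentiableAt_riemannZeta hz).differentiableWithinAt
  subst hs
  -- The exponent is `2` although the pole is simple: `(z - 1) ^ 2 ζ(z)` tends to `0`, its literal
  -- value at `1`, whereas `(z - 1) ζ(z)` tends to `1` and has value `0` there.
  refine ⟨2, analyticAt_of_differentiable_on_punctured_nhds_of_continuousAt ?_ ?_⟩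
  · filter_upwards [self_mem_nhdsWithin] with z hz
    have := differentiableAt_riemannZeta hz
    fun_prop
  · rw [continuousAt_iff_punctured_nhds]
    have h1 : Tendsto (fun z : ℂ => z - 1) (𝓝[≠] 1) (𝓝 0) := by
      have : Continuous fun z : ℂ => z - 1 := by fun_prop
      exact (this.tendsto' 1 0 (by simp)).mono_left nhdsWithin_le_nhds
    have h2 := h1.mul riemannZeta_residue_one
    simp only [sub_self, zero_mul] at h2 ⊢
    simp only [ne_eq, OfNat.ofNat_ne_zero, not_false_eq_true, zero_pow, zero_smul]
    refine h2.congr fun z => ?_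
    rw [smul_eq_mul]; ring

/-- The continuation of the sum over the upper half of the lattice, less the wedge. -/
noncomputable def complementSum (τ : ℂ) (H : ℂ → ℂ) (s : ℂ) : ℂ :=
  upperSum 1 0 τ s - H s / ((s - 1) * (s - 2))

lemma analyticAt_complementSum (τ : ℍ) {H : ℂ → ℂ} (hH : Differentiable ℂ H) {s : ℂ}
    (h1 : s - 1 ≠ 0) (h2 : s - 2 ≠ 0) : AnalyticAt ℂ (complementSum τ H) s := by
  refine (analyticAt_upperSum le_rfl 0 τ (sub_ne_zero.1 h1)).sub ((hH.analyticAt s).div ?_ ?_)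
  · fun_prop
  · exact mul_ne_zero h1 h2

lemma meromorphicOn_complementSum (τ : ℍ) {H : ℂ → ℂ} (hH : Differentiable ℂ H) :
    MeromorphicOn (complementSum τ H) univ := by
  intro s _
  have hq : MeromorphicAt (fun s : ℂ => (s - 1) * (s - 2)) s := by
    apply AnalyticAt.meromorphicAt
    fun_prop
  have hA : MeromorphicAt (axisPart 1) s := by
    have : axisPart 1 = riemannZeta := by ext s; simp [axisPart]
    rw [this]; exact meromorphicAt_riemannZeta s
  have hd : Differentiable ℂ fun s =>
      lipschitzFactor s * ((1 : ℕ) : ℂ) ^ (-s) * qSeries 1 0 τ s :=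
    (differentiable_lipschitzFactor.mul (differentiable_natCast_cpow_neg le_rfl)).mul
      (differentiable_qSeries le_rfl 0 τ.im_pos)
  exact (hA.add (hd.analyticAt s).meromorphicAt).sub ((hH.analyticAt s).meromorphicAt.div hq)

lemma barnesTerm_eq (τ : ℍ) (p : ℕ × ℕ) (s : ℂ) :
    barnesTerm τ (-1) τ p s = eisTerm τ (((p.2 : ℤ) + 1), -(p.1 : ℤ)) s := by
  have hne : (((p.2 : ℤ) + 1), -(p.1 : ℤ)) ≠ (0, 0) := by
    simp only [ne_eq, Prod.mk.injEq]; omega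
  rw [barnesTerm, eisTerm, if_neg hne]
  congr 1
  push_cast
  ring

/-- Removing the wedge from the half lattice leaves the pairs with `m > 0` and `n ≤ 0`, exactly the
points `(n' + 1) τ - m'` of Barnes' series. -/
lemma hasSum_barnesTerm (τ : ℍ) {s w : ℂ} (hs : 2 < s.re)
    (hw : HasSum (fun p => wedgePt 1 0 τ p ^ (-s)) w) :
    HasSum (fun p => barnesTerm τ (-1) τ p s) (upperSum 1 0 τ s - w) := by
  classical
  have ht : IsLatticeType 1 0 := Or.inl ⟨rfl, rfl⟩
  have hall : ∀ p, eisTermMod 1 0 0 τ p s = eisTerm τ p s := fun p => by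
    simp [eisTermMod, Int.modEq_one]
  have h1 := (hasSum_upper ht τ hs).sub (hasSum_wedgePairs ht τ hw)
  have hinj : Function.Injective (fun p : ℕ × ℕ => (((p.2 : ℤ) + 1), -(p.1 : ℤ))) := by
    rintro ⟨m, n⟩ ⟨m', n'⟩ h
    simp only [Prod.mk.injEq] at h ⊢
    omega
  have h2 := (hinj.hasSum_iff ?_).2 h1
  · have hterm : ((fun p => (if p ∈ posPairs then eisTermMod 1 0 0 τ p s else 0) -
        if p ∈ wedgePairs then eisTermMod 1 0 0 τ p s else 0) ∘
        fun p : ℕ × ℕ => (((p.2 : ℤ) + 1), -(p.1 : ℤ))) = fun p => barnesTerm τ (-1) τ p s := by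
      ext p
      have hp : (((p.2 : ℤ) + 1), -(p.1 : ℤ)) ∈ posPairs := by
        simp only [posPairs, mem_ofPred_eq]; omega
      have hp' : (((p.2 : ℤ) + 1), -(p.1 : ℤ)) ∉ wedgePairs := by
        simp only [wedgePairs, mem_ofPred_eq]; omega
      rw [Function.comp, if_pos hp, if_neg hp', sub_zero, hall, barnesTerm_eq]
    rw [hterm] at h2
    exact h2
  · rintro ⟨m, n⟩ hp
    have : (m, n) ∈ posPairs ↔ (m, n) ∈ wedgePairs := by
      refine ⟨fun h => ?_, fun h => wedgePairs_subset h⟩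
      by_contra hw
      apply hp
      simp only [posPairs, wedgePairs, mem_ofPred_eq] at h hw
      exact ⟨((-n).toNat, (m - 1).toNat), by simp only [Prod.mk.injEq]; omega⟩
    simp [this]

lemma isMeromorphicContinuation_barnes (τ : ℍ) {H : ℂ → ℂ} (hH : Differentiable ℂ H)
    (hsum : ∀ s : ℂ, 2 < s.re →
      HasSum (fun p => wedgePt 1 0 τ p ^ (-s)) (H s / ((s - 1) * (s - 2)))) :
    IsMeromorphicContinuation (barnesTerm τ (-1) τ)
      (toMeromorphicNFOn (complementSum τ H) univ) := by
  refine ⟨meromorphicNFOn_toMeromorphicNFOn _ _, fun s hs => ?_⟩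
  rw [(toMeromorphicNFOn_eventuallyEq_of_analyticAt (meromorphicOn_complementSum τ hH)
    (analyticAt_complementSum τ hH (sub_one_ne_zero_of_re hs)
      (sub_two_ne_zero_of_re hs))).eq_of_nhds]
  exact hasSum_barnesTerm τ hs (hsum s hs)

/-- The continuation is `upperSum` minus the wedge sum. It is analytic at `-2 k`, where `upperSum`
is zero, so only the negative of the wedge value remains. -/
theorem barnesZeta_spec (τ : ℍ) {H : ℂ → ℂ} (hH : Differentiable ℂ H)
    (hsum : ∀ s : ℂ, 2 < s.re →
      HasSum (fun p => wedgePt 1 0 τ p ^ (-s)) (H s / ((s - 1) * (s - 2)))) {k : ℕ} (hk : 1 ≤ k) :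
    IsMeromorphicContinuation (barnesTerm τ (-1) τ) (fun s => barnesZeta s τ (-1) τ) ∧
      AnalyticAt ℂ (fun s => barnesZeta s τ (-1) τ) (-2 * k) ∧
      barnesZeta (-2 * k) τ (-1) τ = -wedgeValue H k := by
  have h := isMeromorphicContinuation_barnes τ hH hsum
  have heq : (fun s => barnesZeta s τ (-1) τ) = toMeromorphicNFOn (complementSum τ H) univ :=
    h.meromorphicContinuation_eq
  obtain ⟨n1, n2⟩ := neg_two_mul_sub_ne_zero k
  have ha := analyticAt_complementSum τ hH n1 n2
  have hev := toMeromorphicNFOn_eventuallyEq_of_analyticAt (meromorphicOn_complementSum τ hH) ha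
  refine ⟨heq ▸ h, heq ▸ ha.congr hev.symm, ?_⟩
  have hv : barnesZeta (-2 * k) τ (-1) τ = complementSum τ H (-2 * k) :=
    (congrFun heq _).trans hev.eq_of_nhds
  rw [hv, complementSum, upperSum_neg_two_mul hk, zero_sub, wedgeValue]

/-! ### Rational functions on the upper half plane -/

lemma mul_mem_rationalFunctions {f g : ℍ → ℂ} (hf : f ∈ rationalFunctions)
    (hg : g ∈ rationalFunctions) : (fun τ => f τ * g τ) ∈ rationalFunctions := by
  obtain ⟨P, Q, h⟩ := hf
  obtain ⟨P', Q', h'⟩ := hg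
  refine ⟨P * P', Q * Q', fun τ => ⟨?_, ?_⟩⟩
  · rw [Polynomial.eval_mul]; exact mul_ne_zero (h τ).1 (h' τ).1
  · dsimp only
    rw [(h τ).2, (h' τ).2, Polynomial.eval_mul, Polynomial.eval_mul, div_mul_div_comm]

lemma inv_mem_rationalFunctions {f : ℍ → ℂ} (hf : f ∈ rationalFunctions) (h0 : ∀ τ, f τ ≠ 0) :
    (fun τ => (f τ)⁻¹) ∈ rationalFunctions := by
  obtain ⟨P, Q, h⟩ := hf
  refine ⟨Q, P, fun τ => ⟨fun hP => h0 τ ?_, ?_⟩⟩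
  · rw [(h τ).2, hP, zero_div]
  · dsimp only
    rw [(h τ).2, inv_div]

lemma eval_mem_rationalFunctions (P : Polynomial ℂ) :
    (fun τ : ℍ => P.eval (τ : ℂ)) ∈ rationalFunctions :=
  ⟨P, 1, fun τ => by simp⟩

lemma eval_comp_mem_rationalFunctions (P : Polynomial ℂ) {f : ℍ → ℂ}
    (hf : f ∈ rationalFunctions) : (fun τ => P.eval (f τ)) ∈ rationalFunctions := by
  induction P using Polynomial.induction_on with
  | C c => simpa using eval_mem_rationalFunctions (Polynomial.C c)
  | add p q hp hq => simpa only [Polynomial.eval_add] using! add_mem hp hq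
  | monomial n c h =>
    simpa only [Polynomial.eval_mul, Polynomial.eval_C, Polynomial.eval_pow, Polynomial.eval_X,
      pow_succ, mul_assoc] using! mul_mem_rationalFunctions h hf

lemma zpow_mem_rationalFunctions {f : ℍ → ℂ} (hf : f ∈ rationalFunctions) (h0 : ∀ τ, f τ ≠ 0)
    (n : ℤ) : (fun τ => f τ ^ n) ∈ rationalFunctions := by
  have hpow : ∀ {g : ℍ → ℂ} (n : ℕ), g ∈ rationalFunctions →
      (fun τ => g τ ^ n) ∈ rationalFunctions := fun n hg => by
    simpa using eval_comp_mem_rationalFunctions (Polynomial.X ^ n) hg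
  obtain ⟨n, rfl | rfl⟩ := n.eq_nat_or_neg
  · simpa only [zpow_natCast] using hpow n hf
  · simpa only [zpow_neg, zpow_natCast, inv_pow] using hpow n (inv_mem_rationalFunctions hf h0)

lemma denom_mem_rationalFunctions (γ : SL(2, ℤ)) :
    (fun τ : ℍ => denom γ τ) ∈ rationalFunctions := by
  have := eval_mem_rationalFunctions
    (Polynomial.C ((γ 1 0 : ℤ) : ℂ) * Polynomial.X + Polynomial.C ((γ 1 1 : ℤ) : ℂ))
  simpa [ModularGroup.denom_apply] using! this

lemma coe_smul_mem_rationalFunctions (γ : SL(2, ℤ)) :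
    (fun τ : ℍ => ((γ • τ : ℍ) : ℂ)) ∈ rationalFunctions := by
  have h1 := eval_mem_rationalFunctions
    (Polynomial.C ((γ 0 0 : ℤ) : ℂ) * Polynomial.X + Polynomial.C ((γ 0 1 : ℤ) : ℂ))
  have h2 := inv_mem_rationalFunctions (denom_mem_rationalFunctions γ)
    (fun τ => denom_ne_zero _ τ)
  convert! mul_mem_rationalFunctions h1 h2 using 1
  ext τ
  rw [coe_specialLinearGroup_apply, ModularGroup.denom_apply, div_eq_mul_inv]
  simp

lemma slash_mem_rationalFunctions (m : ℤ) {R : ℍ → ℂ} (hR : R ∈ rationalFunctions)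
    (γ : SL(2, ℤ)) : R ∣[m] γ ∈ rationalFunctions := by
  obtain ⟨P, Q, h⟩ := hR
  have hγ := coe_smul_mem_rationalFunctions γ
  have h1 := mul_mem_rationalFunctions (mul_mem_rationalFunctions
    (eval_comp_mem_rationalFunctions P hγ)
    (inv_mem_rationalFunctions (eval_comp_mem_rationalFunctions Q hγ) fun τ => (h (γ • τ)).1))
    (zpow_mem_rationalFunctions (denom_mem_rationalFunctions γ) (fun τ => denom_ne_zero _ τ) (-m))
  convert! h1 using 1
  ext τ
  rw [ModularForm.SL_slash_apply, (h (γ • τ)).2, div_eq_mul_inv]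

/-- A function invariant under `T` with rational period function for `S` has rational period
functions for the whole modular group. -/
lemma slash_sub_mem_rationalFunctions {m : ℤ} {f : ℍ → ℂ} (hT : f ∣[m] ModularGroup.T = f)
    (hS : f ∣[m] ModularGroup.S - f ∈ rationalFunctions) (γ : SL(2, ℤ)) :
    f ∣[m] γ - f ∈ rationalFunctions := by
  have hsub : ∀ (g h : ℍ → ℂ) (γ : SL(2, ℤ)), (g - h) ∣[m] γ = g ∣[m] γ - h ∣[m] γ := by
    intro g h γ
    rw [sub_eq_add_neg, SlashAction.add_slash, SlashAction.neg_slash, ← sub_eq_add_neg]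
  have hγ : γ ∈ Subgroup.closure {ModularGroup.S, ModularGroup.T} := by
    rw [SpecialLinearGroup.SL2Z_generators]; exact Subgroup.mem_top γ
  induction hγ using Subgroup.closure_induction with
  | mem x hx =>
    rcases hx with rfl | rfl
    · exact hS
    · rw [hT, sub_self]; exact zero_mem _
  | one => rw [SlashAction.slash_one, sub_self]; exact zero_mem _
  | mul x y _ _ hx hy =>
    -- Cocycle relation for the period functions; slashing preserves rationality.
    have : f ∣[m] (x * y) - f = (f ∣[m] x - f) ∣[m] y + (f ∣[m] y - f) := by
      rw [hsub, SlashAction.slash_mul]; abel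
    rw [this]
    exact add_mem (slash_mem_rationalFunctions m hx y) hy
  | inv x _ hx =>
    have : f ∣[m] x⁻¹ - f = -((f ∣[m] x - f) ∣[m] x⁻¹) := by
      rw [hsub, ← SlashAction.slash_mul, mul_inv_cancel, SlashAction.slash_one, neg_sub]
    rw [this]
    exact neg_mem (slash_mem_rationalFunctions m hx x⁻¹)

/-! ### Fourier expansions -/

lemma qTerm_add_natCast {N : ℕ} (hN : 1 ≤ N) (a : ℤ) (z : ℂ) (p : ℕ × ℕ) (s : ℂ) :
    qTerm N a (z + N) p s = qTerm N a z p s := by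
  have hN1 : (N : ℂ) ≠ 0 := Nat.cast_ne_zero.2 (by omega)
  rw [qTerm, qTerm]
  congr 1
  rw [exp_eq_exp_iff_exists_int]
  refine ⟨(N * p.1 + 1) * (p.2 + 1), ?_⟩
  push_cast
  field_simp
  ring

lemma eisDeriv_add_natCast {N : ℕ} (hN : 1 ≤ N) (a : ℤ) (k : ℕ) (z : ℂ) :
    eisDeriv N a k (z + N) = eisDeriv N a k z := by
  simp only [eisDeriv, qSeries, qTerm_add_natCast hN]

lemma hasSum_fiberwise_exp {f : ℕ × ℕ → ℂ} (coef : ℕ × ℕ → ℂ) (E : ℕ × ℕ → ℕ) (e : ℕ → ℂ)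
    (hf : ∀ p, f p = coef p * e (E p)) {w : ℂ} (h : HasSum f w) :
    HasSum (fun n => (∑' p : E ⁻¹' {n}, coef p) * e n) w := by
  refine (h.tsum_fiberwise E).congr_fun fun n => ?_
  rw [← tsum_mul_right]
  refine tsum_congr fun p => ?_
  rw [hf, show E p = n from p.2]

/-- The Fourier expansion of `eisDeriv`, in powers of `exp (2 π i τ / (N d))`. -/
lemma exists_hasSum_eisDeriv {N d : ℕ} (hN : 1 ≤ N) (hd : 1 ≤ d) (a : ℤ) (k : ℕ) :
    ∃ b : ℕ → ℂ, ∀ τ : ℍ,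
      HasSum (fun n : ℕ => b n * exp (2 * Real.pi * I * τ * n / (N * d : ℕ))) (eisDeriv N a k τ) := by
  set c₀ := deriv (axisEntire N) (-2 * k)
  set c₁ := deriv (qFactor N) (-2 * k)
  set coef : ℕ × ℕ → ℂ := fun p => ((p.2 + 1 : ℕ) : ℂ) ^ ((-2 * k : ℂ) - 1) *
    exp (2 * Real.pi * I * (a / N) * (p.2 + 1 : ℕ))
  -- The exponent of each term in powers of `exp (2 π i τ / (N d))`, by which the double series is
  -- grouped. Taking `d = 2` with `N = 1` gives an expansion in `exp (π i τ)`.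
  set E : ℕ × ℕ → ℕ := fun p => d * ((N * p.1 + 1) * (p.2 + 1)) with hE
  refine ⟨fun n => (if n = 0 then c₀ else 0) + c₁ * ∑' p : E ⁻¹' {n}, coef p, fun τ => ?_⟩
  have hN1 : (N : ℂ) ≠ 0 := Nat.cast_ne_zero.2 (by omega)
  have hd1 : (d : ℂ) ≠ 0 := Nat.cast_ne_zero.2 (by omega)
  have hq := hasSum_fiberwise_exp (f := fun p => qTerm N a τ p (-2 * k)) coef E
    (fun n : ℕ => exp (2 * Real.pi * I * τ * n / (N * d : ℕ))) (fun p => by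
      simp only [qTerm, coef, hE]
      rw [mul_assoc (_ ^ _), ← exp_add]
      congr 2
      push_cast
      field_simp
      ring) (summable_qTerm hN a τ.im_pos (-2 * k)).hasSum
  have h0 : HasSum (fun n : ℕ => (if n = 0 then c₀ else 0) *
      exp (2 * Real.pi * I * τ * n / (N * d : ℕ))) c₀ := by
    convert hasSum_single (f := fun n : ℕ => (if n = 0 then c₀ else 0) *
      exp (2 * Real.pi * I * τ * n / (N * d : ℕ))) 0 (fun n hn => by simp [hn]) using 1
    simp
  refine (h0.add (hq.mul_left c₁)).congr_fun fun n => ?_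
  ring

/-! ### The differential Eisenstein series -/

lemma eisTermMod_one (τ : ℍ) : eisTermMod 1 0 0 τ = eisTerm τ := by
  ext p s
  simp [eisTermMod, Int.modEq_one]

lemma genG_eq (τ : ℍ) : (fun s => genG s τ) = eisEntire 1 0 τ := by
  have h := isEntireContinuation_eisEntire (Or.inl ⟨rfl, rfl⟩ : IsLatticeType 1 0) τ
  rw [eisTermMod_one] at h
  exact h.entireContinuation_eq

lemma genGMod_odd_eq (τ : ℍ) : (fun s => genGMod 2 1 1 s τ) = eisEntire 2 1 τ :=
  (isEntireContinuation_eisEntire (Or.inr ⟨rfl, rfl⟩ : IsLatticeType 2 1) τ).entireContinuation_eq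

lemma branchPow_two_mul {z : ℂ} (hz : z ≠ 0) (s : ℂ) :
    branchPow (2 * z) s = (2 : ℂ) ^ s * branchPow z s := by
  have harg : (2 * z).arg = z.arg := by
    simpa using arg_real_mul z (zero_lt_two : (0 : ℝ) < 2)
  have hlog : Real.log ‖2 * z‖ = Real.log 2 + Real.log ‖z‖ := by
    rw [norm_mul, Real.log_mul (by simp) (norm_ne_zero_iff.2 hz)]; simp
  rw [branchPow, branchPow, branchArg, branchArg, harg, hlog,
    cpow_def_of_ne_zero two_ne_zero, ← exp_add]
  congr 1
  have h2 : ((Real.log 2 : ℝ) : ℂ) = log 2 := by rw [ofReal_log zero_le_two, ofReal_ofNat]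
  rw [ofReal_add, h2]
  ring

/-- Pairs with both coordinates even are twice arbitrary pairs, and a positive factor passes through
the branch. -/
lemma hasSum_eisTermMod_even (τ : ℍ) {s : ℂ} (hs : 2 < s.re) :
    HasSum (fun p => eisTermMod 2 0 0 τ p s) ((2 : ℂ) ^ (-s) * eisEntire 1 0 τ s) := by
  have h := (isEntireContinuation_eisEntire (Or.inl ⟨rfl, rfl⟩ : IsLatticeType 1 0) τ).2 s hs
  rw [eisTermMod_one] at h
  have hinj : Function.Injective (fun p : ℤ × ℤ => (2 * p.1, 2 * p.2)) := by
    rintro ⟨m, n⟩ ⟨m', n'⟩ h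
    simpa using h
  refine (hinj.hasSum_iff ?_).1 ((h.mul_left ((2 : ℂ) ^ (-s))).congr_fun fun p => ?_)
  · rintro ⟨m, n⟩ hp
    rw [eisTermMod, if_neg]
    rintro ⟨h1, h2⟩
    apply hp
    simp only [Int.ModEq] at h1 h2
    exact ⟨(m / 2, n / 2), by simp only [Prod.mk.injEq]; push_cast at h1 h2; omega⟩
  · rw [Function.comp, eisTermMod, if_pos (by simp [Int.ModEq]), eisTerm, eisTerm]
    by_cases hp : p = (0, 0)
    · simp [hp]
    · have hp' : (2 * p.1, 2 * p.2) ≠ (0, 0) := by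
        intro h'
        apply hp
        simpa [Prod.ext_iff] using h'
      rw [if_neg hp, if_neg hp', ← branchPow_two_mul (latticePt_ne_zero τ hp)]
      congr 1
      push_cast; ring

lemma isEntireContinuation_even (τ : ℍ) : IsEntireContinuation (eisTermMod 2 0 0 τ)
    (fun s => (2 : ℂ) ^ (-s) * eisEntire 1 0 τ s) := by
  refine ⟨fun s => ?_, fun s hs => hasSum_eisTermMod_even τ hs⟩
  exact DifferentiableAt.mul (differentiableAt_id.neg.const_cpow (Or.inl two_ne_zero))
    ((isEntireContinuation_eisEntire (Or.inl ⟨rfl, rfl⟩ : IsLatticeType 1 0) τ).1 s)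

lemma genGMod_even_eq (τ : ℍ) :
    (fun s => genGMod 2 0 0 s τ) = fun s => (2 : ℂ) ^ (-s) * eisEntire 1 0 τ s :=
  (isEntireContinuation_even τ).entireContinuation_eq

lemma dG_eq (k : ℕ) (τ : ℍ) : dG (-2 * (k : ℤ)) τ = eisDeriv 1 0 k τ := by
  rw [dG, genG_eq]
  push_cast
  exact (hasDerivAt_eisEntire le_rfl 0 k τ).deriv

lemma dGMod_odd_eq (k : ℕ) (τ : ℍ) : dGMod 2 1 1 (-2 * (k : ℤ)) τ = eisDeriv 2 1 k τ := by
  rw [dGMod, genGMod_odd_eq]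
  push_cast
  exact (hasDerivAt_eisEntire one_le_two 1 k τ).deriv

/-- The derivative of `2 ^ (-s)` does not contribute, because the full series vanishes at `-2 k`. -/
lemma dGMod_even_eq {k : ℕ} (hk : 1 ≤ k) (τ : ℍ) :
    dGMod 2 0 0 (-2 * (k : ℤ)) τ = (2 : ℂ) ^ (2 * k : ℂ) * eisDeriv 1 0 k τ := by
  rw [dGMod, genGMod_even_eq]
  have h1 : DifferentiableAt ℂ (fun s : ℂ => (2 : ℂ) ^ (-s)) (-2 * k) :=
    differentiableAt_id.neg.const_cpow (Or.inl two_ne_zero)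
  have h2 := h1.hasDerivAt.mul (hasDerivAt_eisEntire le_rfl 0 k τ)
  rw [eisEntire_neg_two_mul hk, mul_zero, zero_add] at h2
  push_cast
  have h3 := h2.deriv
  rw [show -(-2 * (k : ℂ)) = 2 * k by ring] at h3
  exact h3

lemma mdifferentiable_eisDeriv {N : ℕ} (hN : 1 ≤ N) (a : ℤ) (k : ℕ) :
    MDifferentiable 𝓘(ℂ) 𝓘(ℂ) (fun τ : ℍ => eisDeriv N a k τ) := by
  rw [UpperHalfPlane.mdifferentiable_iff]
  have h : DifferentiableOn ℂ (eisDeriv N a k) {z | 0 < z.im} :=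
    ((differentiableOn_qSeries hN a (-2 * k)).const_mul _).const_add _
  refine h.congr fun z hz => ?_
  rw [Function.comp, ofComplex_apply_of_im_pos hz]

/-- The period function of `eisDeriv` under `τ ↦ -1 / τ` is rational. -/
lemma eisDeriv_period_mem {N : ℕ} {a : ℤ} (h : IsLatticeType N a) {k : ℕ} (hk : 1 ≤ k) :
    (fun τ : ℍ => (τ : ℂ) ^ (-(-2 * (k : ℤ))) * eisDeriv N a k (ModularGroup.S • τ : ℍ) -
      eisDeriv N a k τ) ∈ rationalFunctions := by
  obtain ⟨H, hH, hsum, hval⟩ := exists_wedge_continuation h.pos h.nonneg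
  obtain ⟨R, hR⟩ := hval (2 * k)
  refine ⟨Polynomial.C (-(2 * Real.pi * I) / ((-2 * k - 1) * (-2 * k - 2))) * R, Polynomial.X,
    fun τ => ⟨by simpa using τ.ne_zero, ?_⟩⟩
  have hRτ : H τ (-2 * k) = R.eval (τ : ℂ) / τ := by
    rw [← hR τ]; congr 1; push_cast; ring
  dsimp only
  rw [eisDeriv_S_smul h hk τ (hH τ) (hsum τ), ← mul_assoc, ← zpow_add₀ τ.ne_zero,
    neg_add_cancel, zpow_zero, wedgeValue, hRτ, Polynomial.eval_mul, Polynomial.eval_C,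
    Polynomial.eval_X]
  ring

theorem dG_mem {k : ℕ} (hk : 1 ≤ k) : dG (-2 * (k : ℤ)) ∈ M ⊤ 1 (-2 * (k : ℤ)) rationalFunctions := by
  have heq : dG (-2 * (k : ℤ)) = fun τ : ℍ => eisDeriv 1 0 k τ := funext (dG_eq k)
  have hper : ∀ τ : ℍ, dG (-2 * (k : ℤ)) ((1 : ℝ) +ᵥ τ) = dG (-2 * (k : ℤ)) τ := fun τ => by
    have := eisDeriv_add_natCast (le_refl 1) 0 k (τ : ℂ)
    rw [dG_eq, dG_eq, coe_vadd, ofReal_one, add_comm]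
    simpa using this
  have hT : dG (-2 * (k : ℤ)) ∣[-2 * (k : ℤ)] ModularGroup.T = dG (-2 * (k : ℤ)) := by
    ext τ
    rw [ModularForm.SL_slash_apply, ModularGroup.denom_apply, modular_T_smul, hper]
    simp [ModularGroup.T]
  have hS : dG (-2 * (k : ℤ)) ∣[-2 * (k : ℤ)] ModularGroup.S - dG (-2 * (k : ℤ))
      ∈ rationalFunctions := by
    convert! eisDeriv_period_mem (Or.inl ⟨rfl, rfl⟩ : IsLatticeType 1 0) hk using 1
    ext τ
    rw [Pi.sub_apply, ModularForm.SL_slash_apply, ModularGroup.denom_S, dG_eq, dG_eq, mul_comm]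
  have hγ := slash_sub_mem_rationalFunctions hT hS
  refine ⟨?_, fun τ => ?_, fun γ _ => hγ γ, fun γ => ?_⟩
  · rw [heq]; exact mdifferentiable_eisDeriv le_rfl 0 k
  · rw [Nat.cast_one]; exact hper τ
  · obtain ⟨b, hb⟩ := exists_hasSum_eisDeriv (le_refl 1) (le_refl 1) 0 k
    -- Taking the period function itself as the rational part leaves `f`, so the one expansion of
    -- `f` serves for every `γ`.
    refine ⟨fun n => if 0 ≤ n then b n.toNat else 0, 0, _, fun n hn => if_neg (by omega), hγ γ,
      fun τ => ?_⟩
    rw [Pi.sub_apply, sub_sub_cancel, dG_eq]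
    have hinj : Function.Injective (Nat.cast : ℕ → ℤ) := Nat.cast_injective
    refine (hinj.hasSum_iff fun n hn => ?_).1 ((hb τ).congr_fun fun n => ?_)
    · dsimp only
      rw [if_neg, zero_mul]
      intro h
      exact hn ⟨n.toNat, Int.toNat_of_nonneg h⟩
    · simp

theorem dGMod_odd_mem {k : ℕ} (hk : 1 ≤ k) :
    dGMod 2 1 1 (-2 * (k : ℤ)) ∈ MG2 (-2 * (k : ℤ)) rationalFunctions := by
  have heq : dGMod 2 1 1 (-2 * (k : ℤ)) = fun τ : ℍ => eisDeriv 2 1 k τ := funext (dGMod_odd_eq k)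
  rw [heq]
  refine ⟨mdifferentiable_eisDeriv one_le_two 1 k, fun τ => ?_,
    eisDeriv_period_mem (Or.inr ⟨rfl, rfl⟩ : IsLatticeType 2 1) hk, ?_⟩
  · have := eisDeriv_add_natCast one_le_two 1 k (τ : ℂ)
    dsimp only
    rw [coe_vadd, add_comm]
    simpa using this
  · obtain ⟨b, hb⟩ := exists_hasSum_eisDeriv one_le_two (le_refl 1) 1 k
    refine ⟨b, fun τ => (hb τ).congr_fun fun n => ?_⟩
    congr 2
    push_cast
    ring

theorem dGMod_even_mem {k : ℕ} (hk : 1 ≤ k) :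
    dGMod 2 0 0 (-2 * (k : ℤ)) ∈ MG2 (-2 * (k : ℤ)) rationalFunctions := by
  have heq : dGMod 2 0 0 (-2 * (k : ℤ)) =
      (2 : ℂ) ^ (2 * k : ℂ) • fun τ : ℍ => eisDeriv 1 0 k τ := funext (dGMod_even_eq hk)
  rw [heq]
  refine ⟨(mdifferentiable_eisDeriv le_rfl 0 k).const_smul _, fun τ => ?_, ?_, ?_⟩
  -- The full series has period `1`; applying this twice gives period `2`.
  · have h1 := eisDeriv_add_natCast (le_refl 1) 0 k (τ : ℂ)
    have h2 := eisDeriv_add_natCast (le_refl 1) 0 k ((τ : ℂ) + (1 : ℕ))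
    have h3 : (τ : ℂ) + (1 : ℕ) + (1 : ℕ) = 2 + τ := by push_cast; ring
    rw [h3] at h2
    simp only [Pi.smul_apply, coe_vadd, ofReal_ofNat, h2, h1]
  · convert! rationalFunctions.smul_mem ((2 : ℂ) ^ (2 * k : ℂ))
      (eisDeriv_period_mem (Or.inl ⟨rfl, rfl⟩ : IsLatticeType 1 0) hk) using 1
    ext τ
    simp only [Pi.smul_apply, smul_eq_mul]
    ring
  · obtain ⟨b, hb⟩ := exists_hasSum_eisDeriv (le_refl 1) one_le_two 0 k
    refine ⟨fun n => (2 : ℂ) ^ (2 * k : ℂ) * b n,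
      fun τ => ((hb τ).mul_left ((2 : ℂ) ^ (2 * k : ℂ))).congr_fun fun n => ?_⟩
    rw [← mul_assoc]
    congr 2
    push_cast
    ring_nf

theorem dG_S_smul {k : ℕ} (hk : 1 ≤ k) (τ : ℍ) {H : ℂ → ℂ} (hH : Differentiable ℂ H)
    (hsum : ∀ s : ℂ, 2 < s.re →
      HasSum (fun p => wedgePt 1 0 τ p ^ (-s)) (H s / ((s - 1) * (s - 2)))) :
    dG (-2 * (k : ℤ)) (ModularGroup.S • τ) = (-1 / (τ : ℂ)) ^ (2 * k) *
      (dG (-2 * (k : ℤ)) τ + 2 * Real.pi * I * barnesZeta (-2 * (k : ℂ)) (τ : ℂ) (-1) (τ : ℂ)) := by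
  have hpow : (-1 / (τ : ℂ)) ^ (2 * k) = (τ : ℂ) ^ (-2 * k : ℤ) := by
    rw [div_pow, pow_mul, neg_one_sq, one_pow, one_div, neg_mul, zpow_neg]
    congr 1
  rw [dG_eq, dG_eq, eisDeriv_S_smul (Or.inl ⟨rfl, rfl⟩) hk τ hH hsum,
    (barnesZeta_spec τ hH hsum hk).2.2, hpow]
  ring

end DiffEisenstein

theorem corollary5p8 (k : ℕ) (hk : 1 ≤ k) :
    (∀ τ : ℍ,
      DiffEisenstein.IsEntireContinuation (DiffEisenstein.eisTerm τ)
        (fun s => DiffEisenstein.genG s τ) ∧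
      DiffEisenstein.IsEntireContinuation (DiffEisenstein.eisTermMod 2 0 0 τ)
        (fun s => DiffEisenstein.genGMod 2 0 0 s τ) ∧
      DiffEisenstein.IsEntireContinuation (DiffEisenstein.eisTermMod 2 1 1 τ)
        (fun s => DiffEisenstein.genGMod 2 1 1 s τ)) ∧
    DiffEisenstein.dG (-2 * (k : ℤ)) ∈
      DiffEisenstein.M ⊤ 1 (-2 * (k : ℤ)) DiffEisenstein.rationalFunctions ∧
    DiffEisenstein.dGMod 2 0 0 (-2 * (k : ℤ)) ∈
      DiffEisenstein.MG2 (-2 * (k : ℤ)) DiffEisenstein.rationalFunctions ∧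
    DiffEisenstein.dGMod 2 1 1 (-2 * (k : ℤ)) ∈
      DiffEisenstein.MG2 (-2 * (k : ℤ)) DiffEisenstein.rationalFunctions ∧
    (∀ τ : ℍ,
      DiffEisenstein.IsMeromorphicContinuation (DiffEisenstein.barnesTerm (τ : ℂ) (-1) (τ : ℂ))
        (fun s => DiffEisenstein.barnesZeta s (τ : ℂ) (-1) (τ : ℂ)) ∧
      AnalyticAt ℂ (fun s => DiffEisenstein.barnesZeta s (τ : ℂ) (-1) (τ : ℂ)) (-2 * (k : ℂ)) ∧
      DiffEisenstein.dG (-2 * (k : ℤ)) (ModularGroup.S • τ) =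
        (-1 / (τ : ℂ)) ^ (2 * k) *
          (DiffEisenstein.dG (-2 * (k : ℤ)) τ +
            2 * Real.pi * I * DiffEisenstein.barnesZeta (-2 * (k : ℂ)) (τ : ℂ) (-1) (τ : ℂ))) := by
  open DiffEisenstein in
  refine ⟨fun τ => ⟨?_, ?_, ?_⟩, dG_mem hk, dGMod_even_mem hk, dGMod_odd_mem hk, fun τ => ?_⟩
  · rw [genG_eq, ← eisTermMod_one]
    exact isEntireContinuation_eisEntire (Or.inl ⟨rfl, rfl⟩) τ
  · rw [genGMod_even_eq]
    exact isEntireContinuation_even τ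
  · rw [genGMod_odd_eq]
    exact isEntireContinuation_eisEntire (Or.inr ⟨rfl, rfl⟩) τ
  · obtain ⟨H, hH, hsum, -⟩ := exists_wedge_continuation (le_refl 1) (le_refl 0)
    obtain ⟨h1, h2, -⟩ := barnesZeta_spec τ (hH τ) (hsum τ) hk
    exact ⟨h1, h2, dG_S_smul hk τ (hH τ) (hsum τ)⟩
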